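/- Model: a word RAM whose words have $W=\kappa(\lfloor\log_2 n\rfloor+1)$ bits, where $n$ is the length of the input string and $\kappa$ is any sufficiently large constant. A problem is solved in $O(f(n))$ space with $O(1)$ query time if there are a constant $\kappa_0$ and, for every constant $\kappa\ge\kappa_0$, a single query program and constants $T,A$ (independent of the instance) such that for every instance, with string of length $n$, there is a memory content of at most $A\,f(n)$ words with which the program answers every query correctly within $T$ steps. The generalised suffix tree of strings $w_1,\dots,w_\beta$ is the compacted trie of all suffixes of $w_1\$_1,\dots,w_\beta\$_\beta$, where the $\$_i$ are distinct letters that occur in none of the $w_i$; the suffix tree of $w$ is the case $\beta=1$. To retrieve the node of a string in such a tree means to return a pointer to this node if it is explicit, and a pointer to the edge on which it lies if it is implicit (and to tell which is the case); pointers are given by an arbitrary numbering $0,1,\dots,N-1$ of the explicit nodes of the tree, and a pointer to an edge is the pointer to its lower endpoint. General substring retrieval: given a string $w$ of length $n$, preprocess its suffix tree so that for any positions $i\le j$ of $w$ the node of $w[i..j]$ in this tree can be retrieved. Long substring retrieval: given a string $w$ of length $n$, an integer $\ell\ge 1$ and documents $w_1,\dots,w_\beta$ which are substrings of $w$, all of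 length $\ell$, with $\beta=O(n/\ell)$ (that is, $\beta\ell\le cn$ for a constant $c$), preprocess their generalised suffix tree so that for any $k$ and $i\le j$ with $j-i+1\ge\frac34\ell$ the node of $w_k[i..j]$ in this tree can be retrieved. It is solved in $O(f(n))$ space with $O(1)$ query time if this holds for every constant $c$, where $\kappa_0$, the program and the constants $T,A$ may depend on $c$. **Lemma.** Let $S:\mathbb N\to\mathbb N$ be any function. If long substring retrieval for strings over an alphabet $\sigma$ can be solved in $O(S(n))$ space with $O(1)$ query time, then general substring retrieval for strings over $\sigma$ can be solved in $O\big((S(n)+n)(\lfloor\log_2 n\rfloor+1)\big)$ space with $O(1)$ query time; for $n\ge 2$ this bound is $O((S(n)+n)\log n)$. -/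

import Mathlib

namespace SubstringRetrieval

/-! ### The word RAM

Words of `W` bits are the natural numbers below `2 ^ W`; all arithmetic is reduced modulo `2 ^ W`. -/

/-- The binary word operations, each of unit cost. -/
inductive WordOp
  | add | sub | mul | div | mod | and | or | xor | shl | shr

/-- Value of an operation on two words of `W` bits. -/
def WordOp.eval (W : ℕ) : WordOp → ℕ → ℕ → ℕ
  | .add, a, b => (a + b) % 2 ^ W
  | .sub, a, b => (a + (2 ^ W - b)) % 2 ^ W
  | .mul, a, b => (a * b) % 2 ^ W
  | .div, a, b => a / b
  | .mod, a, b => a % b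
  | .and, a, b => a &&& b
  | .or, a, b => a ||| b
  | .xor, a, b => a ^^^ b
  | .shl, a, b => (a * 2 ^ b) % 2 ^ W
  | .shr, a, b => a / 2 ^ b

/-- Instructions of a query program. `const d c` puts the constant `c` into register `d`;
`binop o d a b` applies `o` to registers `a`, `b` and puts the result into register `d`;
`load d a` reads the memory cell whose address is in register `a` into register `d`;
`jumpLt a b t` jumps to instruction `t` if the content of register `a` is less than that
of register `b`. -/
inductive Instr
  | const (d c : ℕ)
  | binop (o : WordOp) (d a b : ℕ)
  | load (d a : ℕ)
  | jumpLt (a b t : ℕ)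

/-- Program counter and register contents. (A program, being finite, uses only constantly many
registers.) -/
structure Config where
  pc : ℕ
  reg : ℕ → ℕ

/-- Effect of one instruction; `D` is the (read-only) preprocessed memory, and cells outside of it
contain `0`. -/
def Instr.exec (W : ℕ) (D : List ℕ) (s : Config) : Instr → Config
  | .const d c => ⟨s.pc + 1, Function.update s.reg d (c % 2 ^ W)⟩
  | .binop o d a b => ⟨s.pc + 1, Function.update s.reg d (o.eval W (s.reg a) (s.reg b))⟩
  | .load d a => ⟨s.pc + 1, Function.update s.reg d (D.getD (s.reg a) 0)⟩
  | .jumpLt a b t => ⟨if s.reg a < s.reg b then t else s.pc + 1, s.reg⟩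

/-- One step of a program; the machine has halted, and no longer changes, once the program counter
has left the program. -/
def step (W : ℕ) (P : List Instr) (D : List ℕ) (s : Config) : Config :=
  match P[s.pc]? with
  | some ins => ins.exec W D s
  | none => s

/-- At the start the input words are in registers `0, 1, 2, …`, all other registers are `0`. -/
def initConfig (input : List ℕ) : Config := ⟨0, fun r => input.getD r 0⟩

/-- Run on memory `D` and the given input, program `P` halts within `T` steps, and the contents of
registers `0` and `1` are then related by `good`. -/
def Answers (W : ℕ) (P : List Instr) (T : ℕ) (D : List ℕ) (input : List ℕ)
    (good : ℕ → ℕ → Prop) : Prop :=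
  let s := (step W P D)^[T] (initConfig input)
  P.length ≤ s.pc ∧ good (s.reg 0) (s.reg 1)

/-- Logarithmic word size, with constant factor `κ`. -/
def wordSize (κ n : ℕ) : ℕ := κ * (Nat.log 2 n + 1)

/-! ### Generalised suffix trees

A node of the trie, explicit or implicit, is identified with the string that it represents.
The separator `$ᵢ` is the letter `Sum.inr i`. -/

section Tree

variable {σ : Type*} {β : ℕ}

/-- The `i`-th document followed by its separator. -/
def terminated (docs : Fin β → List σ) (i : Fin β) : List (σ ⊕ Fin β) :=
  (docs i).map Sum.inl ++ [Sum.inr i]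

/-- The (explicit or implicit) nodes of the generalised suffix tree: all prefixes of suffixes of the
terminated documents. -/
def IsNode (docs : Fin β → List σ) (x : List (σ ⊕ Fin β)) : Prop :=
  ∃ i, ∃ y, y <:+ terminated docs i ∧ x <+: y

/-- The explicit nodes: the root, the leaves and the branching nodes. -/
def IsExplicit (docs : Fin β → List σ) (x : List (σ ⊕ Fin β)) : Prop :=
  IsNode docs x ∧
    (x = [] ∨ (¬ ∃ a, IsNode docs (x ++ [a])) ∨
      ∃ a b, a ≠ b ∧ IsNode docs (x ++ [a]) ∧ IsNode docs (x ++ [b]))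

/-- `(u, v)` is an edge of the compacted trie, `v` being its lower endpoint. -/
def IsEdge (docs : Fin β → List σ) (u v : List (σ ⊕ Fin β)) : Prop :=
  IsExplicit docs u ∧ IsExplicit docs v ∧ u <+: v ∧ u ≠ v ∧
    ∀ x, IsExplicit docs x → u <+: x → x <+: v → x = u ∨ x = v

/-- Pointers: `ptr` numbers the explicit nodes by `0, 1, …, N - 1`, where `N` is their number, in
some arbitrary order. -/
def IsPointerMap (docs : Fin β → List σ) (ptr : List (σ ⊕ Fin β) → ℕ) : Prop :=
  ∃ N, Set.BijOn ptr {x | IsExplicit docs x} (Set.Iio N)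

/-- `(kind, p)` points to the node of the string `s`: if this node is explicit, then `kind = 0` and
`p` is the pointer to it; if it is implicit, then `kind = 1` and `p` is the pointer to the edge on
which it lies, an edge being pointed to through its lower endpoint. -/
def PointsTo (docs : Fin β → List σ) (ptr : List (σ ⊕ Fin β) → ℕ) (s : List σ)
    (kind p : ℕ) : Prop :=
  let x : List (σ ⊕ Fin β) := s.map Sum.inl
  (IsExplicit docs x ∧ kind = 0 ∧ p = ptr x) ∨
    (¬ IsExplicit docs x ∧ kind = 1 ∧
      ∃ u v, IsEdge docs u v ∧ u <+: x ∧ x <+: v ∧ p = ptr v)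

end Tree

/-- The substring of `w` from position `i` to position `j`, both inclusive, counted from `0`. -/
def substr {σ : Type*} (w : List σ) (i j : ℕ) : List σ := (w.drop i).take (j + 1 - i)

/-! ### The two problems -/

/-- Long substring retrieval for strings over `σ` can be solved in `O(f n)` space with `O(1)` query
time on a word RAM with logarithmic word size.

An instance consists of a string `w` of length `n`, a length `ℓ`, and `β ≤ c n / ℓ` documents of
length `ℓ`, the `k`-th being the substring of `w` that starts at `start k`. A query `(k, i, j)` asks
for the node of the substring `i..j` of the `k`-th document, of length at least `3 ℓ / 4`, in the
generalised suffix tree of the documents. The constants and the query program may depend on the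
constant `c` and on the word size constant `κ`, which may be any sufficiently large one, but not on
the instance. -/
def LongSolvable (σ : Type*) (f : ℕ → ℕ) : Prop :=
  ∀ c : ℕ, ∃ κ₀ : ℕ, ∀ κ ≥ κ₀, ∃ (P : List Instr) (T A : ℕ),
    ∀ (w : List σ) (ℓ β : ℕ) (start : Fin β → ℕ) (ptr : List (σ ⊕ Fin β) → ℕ),
      0 < ℓ → β * ℓ ≤ c * w.length → (∀ k, start k + ℓ ≤ w.length) →
      let docs : Fin β → List σ := fun k => (w.drop (start k)).take ℓ
      IsPointerMap docs ptr →
      ∃ D : List ℕ, D.length ≤ A * f w.length ∧ (∀ x ∈ D, x < 2 ^ wordSize κ w.length) ∧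
        ∀ (k : Fin β) (i j : ℕ), i ≤ j → j < ℓ → 3 * ℓ ≤ 4 * (j + 1 - i) →
          Answers (wordSize κ w.length) P T D [k, i, j]
            (PointsTo docs ptr (substr (docs k) i j))

/-- General substring retrieval for strings over `σ` can be solved in `O(f n)` space with `O(1)`
query time on a word RAM with logarithmic word size.

An instance is a string `w` of length `n`; a query `(i, j)` asks for the node of the substring
`i..j` of `w` in the suffix tree of `w`, that is, the generalised suffix tree of the one
document `w`. -/
def GeneralSolvable (σ : Type*) (f : ℕ → ℕ) : Prop :=
  ∃ κ₀ : ℕ, ∀ κ ≥ κ₀, ∃ (P : List Instr) (T A : ℕ),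
    ∀ (w : List σ) (ptr : List (σ ⊕ Fin 1) → ℕ),
      let docs : Fin 1 → List σ := fun _ => w
      IsPointerMap docs ptr →
      ∃ D : List ℕ, D.length ≤ A * f w.length ∧ (∀ x ∈ D, x < 2 ^ wordSize κ w.length) ∧
        ∀ i j : ℕ, i ≤ j → j < w.length →
          Answers (wordSize κ w.length) P T D [i, j]
            (PointsTo docs ptr (substr w i j))

end SubstringRetrieval

/-! The lengths `m` of substrings are distributed over `O(log n)` scales. On a scale with step width
`s` and document length `ℓ`, the documents are the windows of `w` of length `ℓ` that start at
multiples of `s`, the last ones being shifted left so as to fit into `w`. For `m ≥ 8`, with `s` the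
power of two such that `8 s ≤ m < 16 s`, the choice `ℓ = (⌊m / s⌋ + 2) s` (or `n`, if that is less)
has three effects: a window of length `m + 1` still fits into a document, `ℓ ≤ m + 2 s ≤ 5 m / 4`
makes the query a long one, and the documents have total length `O(n)`. Each `m < 8` has a scale of
its own, with `s = 1` and `ℓ = m`.

Long substring retrieval yields a pointer in the tree of the documents, which has to be turned into
one in the tree of `w`. Since the documents contain all substrings of length at most `m + 1`, and
one of them is a suffix of `w`, every explicit node of the tree of `w` of depth at most `m` is
explicit in the tree of the documents (`IsExplicit.of_cover`). Hence the strings of one scale that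
lie inside one edge of the latter tree have the same pointer in the tree of `w`, and a table with
one entry per pointer does the translation (`exists_pointsTo_of_pointsTo`, `exists_translation`). It
has size `O(n)`, because a compacted trie has linearly many explicit nodes (`encard_explicit_le`).

On the machine, a query looks up the scale of its length and the record of its position, simulates
the given program on the memory segment of that scale, and translates the result
(`answers_queryProgram`). The simulated program runs with shorter words. It thus reaches only
boundedly many cells, so that all scales together remain addressable however large `S n` is. All
scales use the same `w`, so `S` is only evaluated at `n` and needs no regularity. -/

namespace SubstringRetrieval

/-! ### Nodes of generalised suffix trees -/

section Nodes

variable {σ : Type*} {β : ℕ}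

/-- Erasing separators is left inverse to the embedding of `σ`; it pulls prefix, suffix and infix
relations back to strings over `σ`. -/
theorem filterMap_getLeft_map_inl {τ : Type*} (s : List σ) :
    (s.map (Sum.inl : σ → σ ⊕ τ)).filterMap Sum.getLeft? = s := by
  induction s with
  | nil => rfl
  | cons a s ih => simp [ih]

theorem isNode_iff_infix {docs : Fin β → List σ} {x : List (σ ⊕ Fin β)} :
    IsNode docs x ↔ ∃ i, x <:+: terminated docs i := by
  constructor
  · rintro ⟨i, y, hy, hx⟩
    exact ⟨i, hx.isInfix.trans hy.isInfix⟩
  · rintro ⟨i, p, q, h⟩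
    exact ⟨i, x ++ q, ⟨p, by simpa using h⟩, List.prefix_append _ _⟩

theorem IsNode.of_prefix {docs : Fin β → List σ} {x y : List (σ ⊕ Fin β)}
    (h : IsNode docs y) (hxy : x <+: y) : IsNode docs x := by
  obtain ⟨i, z, hz, hy⟩ := h
  exact ⟨i, z, hz, hxy.trans hy⟩

theorem isNode_map_inl {docs : Fin β → List σ} {i : Fin β} {s : List σ} (h : s <:+: docs i) :
    IsNode docs (s.map Sum.inl) :=
  isNode_iff_infix.2 ⟨i, (h.map Sum.inl).trans (List.prefix_append _ _).isInfix⟩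

theorem isNode_map_inl_append_inr {docs : Fin β → List σ} {i : Fin β} {s : List σ}
    (h : s <:+ docs i) : IsNode docs (s.map Sum.inl ++ [Sum.inr i]) := by
  obtain ⟨p, hp⟩ := h
  exact isNode_iff_infix.2 ⟨i, p.map Sum.inl, [], by simp [terminated, ← hp]⟩

theorem IsNode.infix_of_map_inl {docs : Fin β → List σ} {s : List σ}
    (h : IsNode docs (s.map Sum.inl)) : ∃ i, s <:+: docs i := by
  obtain ⟨i, hi⟩ := isNode_iff_infix.1 h
  refine ⟨i, ?_⟩
  have := hi.filterMap Sum.getLeft?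
  rwa [terminated, List.filterMap_append, filterMap_getLeft_map_inl, filterMap_getLeft_map_inl,
    List.filterMap_cons_none (by rfl), List.filterMap_nil, List.append_nil] at this

/-- A separator occurs only as the last letter of its own document, so nothing can follow it and
what precedes it is a suffix of that document. -/
theorem IsNode.suffix_of_append_inr {docs : Fin β → List σ} {s : List σ} {k : Fin β}
    (h : IsNode docs (s.map Sum.inl ++ [Sum.inr k])) : s <:+ docs k := by
  obtain ⟨i, p, q, h⟩ := isNode_iff_infix.1 h
  rw [terminated] at h
  rcases List.eq_nil_or_concat q with rfl | ⟨q, e, rfl⟩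
  · rw [List.append_nil, ← List.append_assoc] at h
    obtain ⟨h1, h2⟩ := List.append_inj' h rfl
    obtain rfl : k = i := by simpa using h2
    have h3 : s.map Sum.inl <:+ (docs k).map (Sum.inl : σ → σ ⊕ Fin β) := ⟨p, h1⟩
    simpa only [filterMap_getLeft_map_inl] using h3.filterMap Sum.getLeft?
  · rw [List.concat_eq_append, ← List.append_assoc] at h
    obtain ⟨h1, -⟩ := List.append_inj' h rfl
    have h2 : (Sum.inr k : σ ⊕ Fin β) ∈ (docs i).map Sum.inl := by
      rw [← h1]; simp
    simp at h2

/-- Strings without separators are not leaves. -/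
theorem IsNode.exists_append_of_map_inl {docs : Fin β → List σ} {s : List σ}
    (h : IsNode docs (s.map Sum.inl)) : ∃ a, IsNode docs (s.map Sum.inl ++ [a]) := by
  obtain ⟨i, p, q, h⟩ := h.infix_of_map_inl
  cases q with
  | nil => exact ⟨_, isNode_map_inl_append_inr ⟨p, by simpa using h⟩⟩
  | cons a q =>
    refine ⟨Sum.inl a, ?_⟩
    have : IsNode docs ((s ++ [a]).map Sum.inl) :=
      isNode_map_inl (i := i) ⟨p, q, by simpa using h⟩
    simpa using this

/-- If the documents contain all sufficiently short substrings of `w`, and one of them ends with all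
sufficiently short suffixes of `w`, then explicit nodes of the suffix tree of `w` remain explicit. -/
theorem IsExplicit.of_cover {docs : Fin β → List σ} {w s : List σ}
    (hcov : ∀ r, r <:+: w → r.length ≤ s.length + 1 → ∃ k, r <:+: docs k)
    (hlast : ∃ k, ∀ r, r <:+ w → r.length ≤ s.length → r <:+ docs k)
    (h : IsExplicit (fun _ : Fin 1 => w) (s.map Sum.inl)) : IsExplicit docs (s.map Sum.inl) := by
  obtain ⟨hn, h⟩ := h
  obtain ⟨k, hk⟩ := hlast
  have hn' : IsNode docs (s.map Sum.inl) := by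
    obtain ⟨-, hs⟩ := hn.infix_of_map_inl
    obtain ⟨k, hk⟩ := hcov s hs (Nat.le_succ _)
    exact isNode_map_inl hk
  refine ⟨hn', ?_⟩
  have hl : ∀ c, IsNode (fun _ : Fin 1 => w) (s.map Sum.inl ++ [Sum.inl c]) →
      IsNode docs (s.map Sum.inl ++ [Sum.inl c]) := by
    intro c hc
    have h1 : IsNode (fun _ : Fin 1 => w) ((s ++ [c]).map Sum.inl) := by simpa using hc
    obtain ⟨-, h2⟩ := h1.infix_of_map_inl
    obtain ⟨k, hk⟩ := hcov _ h2 (by simp)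
    simpa using isNode_map_inl hk
  -- The separator follows `s` in the tree of `w` only if `s` is a suffix of `w`, hence of document
  -- `k`.
  have hr : ∀ e, IsNode (fun _ : Fin 1 => w) (s.map Sum.inl ++ [Sum.inr e]) →
      IsNode docs (s.map Sum.inl ++ [Sum.inr k]) := fun e he =>
    isNode_map_inl_append_inr (hk _ he.suffix_of_append_inr le_rfl)
  rcases h with h | h | ⟨a, b, hab, ha, hb⟩
  · left; simpa using h
  · exact absurd hn.exists_append_of_map_inl h
  · right; right
    rcases a with a | a <;> rcases b with b | b
    · exact ⟨Sum.inl a, Sum.inl b, fun h => hab (by simpa using h), hl a ha, hl b hb⟩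
    · exact ⟨Sum.inl a, Sum.inr k, by simp, hl a ha, hr b hb⟩
    · exact ⟨Sum.inr k, Sum.inl b, by simp, hr a ha, hl b hb⟩
    -- The tree of `w` has a single separator, which cannot supply both branches.
    · exact absurd (congrArg Sum.inr (Subsingleton.elim a b)) hab

/-- Without explicit nodes below `x` there would be no leaf below it, and `x` could be extended
beyond the total length of the documents. -/
theorem IsNode.exists_explicit_extension {docs : Fin β → List σ} {x : List (σ ⊕ Fin β)}
    (h : IsNode docs x) : ∃ v, IsExplicit docs v ∧ x <+: v := by
  by_contra! hne
  have key : ∀ m, ∃ v, IsNode docs v ∧ x <+: v ∧ m ≤ v.length := by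
    intro m
    induction m with
    | zero => exact ⟨x, h, List.prefix_rfl, Nat.zero_le _⟩
    | succ m ih =>
      obtain ⟨v, hv, hxv, hm⟩ := ih
      by_cases he : ∃ a, IsNode docs (v ++ [a])
      · obtain ⟨a, ha⟩ := he
        exact ⟨_, ha, hxv.trans (List.prefix_append _ _), by simpa using hm⟩
      · exact absurd hxv (hne v ⟨hv, Or.inr (Or.inl he)⟩)
  obtain ⟨v, hv, -, hm⟩ := key ((∑ i, (terminated docs i).length) + 1)
  obtain ⟨i, hi⟩ := isNode_iff_infix.1 hv
  have h1 := hi.length_le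
  have h2 := Finset.single_le_sum (f := fun i => (terminated docs i).length)
    (fun i _ => Nat.zero_le _) (Finset.mem_univ i)
  omega

/-- Every node that is not explicit lies on an edge. -/
theorem IsNode.exists_edge {docs : Fin β → List σ} {x : List (σ ⊕ Fin β)} (h : IsNode docs x)
    (hx : ¬ IsExplicit docs x) : ∃ u v, IsEdge docs u v ∧ u <+: x ∧ x <+: v := by
  classical
  have hv : ∃ m, ∃ v, IsExplicit docs v ∧ x <+: v ∧ v.length = m := by
    obtain ⟨v, h1, h2⟩ := h.exists_explicit_extension
    exact ⟨_, v, h1, h2, rfl⟩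
  -- Minimising the difference of lengths selects the longest explicit prefix of `x`.
  have hu : ∃ m, ∃ u, IsExplicit docs u ∧ u <+: x ∧ u.length + m = x.length :=
    ⟨x.length, [], ⟨h.of_prefix (List.nil_prefix), Or.inl rfl⟩, List.nil_prefix, by simp⟩
  obtain ⟨v, hve, hxv, hvl⟩ := Nat.find_spec hv
  obtain ⟨u, hue, hux, hul⟩ := Nat.find_spec hu
  refine ⟨u, v, ⟨hue, hve, hux.trans hxv, ?_, ?_⟩, hux, hxv⟩
  · rintro rfl
    exact hx (hux.eq_of_length_le hxv.length_le ▸ hue)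
  · intro y hy huy hyv
    rcases List.prefix_or_prefix_of_prefix hyv hxv with hyx | hxy
    · left
      have h1 := Nat.find_min' hu (m := x.length - y.length)
        ⟨y, hy, hyx, by have := hyx.length_le; omega⟩
      have h2 := hyx.length_le
      exact (huy.eq_of_length_le (by omega)).symm
    · right
      have h1 := Nat.find_min' hv ⟨y, hy, hxy, rfl⟩
      exact hyv.eq_of_length_le (by omega)

theorem IsNode.exists_pointsTo {docs : Fin β → List σ} (ptr : List (σ ⊕ Fin β) → ℕ) {s : List σ}
    (h : IsNode docs (s.map Sum.inl)) : ∃ kind p, PointsTo docs ptr s kind p := by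
  by_cases hs : IsExplicit docs (s.map Sum.inl)
  · exact ⟨0, _, Or.inl ⟨hs, rfl, rfl⟩⟩
  · obtain ⟨u, v, he, hu, hv⟩ := h.exists_edge hs
    exact ⟨1, _, Or.inr ⟨hs, rfl, u, v, he, hu, hv, rfl⟩⟩

theorem PointsTo.kind_le {docs : Fin β → List σ} {ptr : List (σ ⊕ Fin β) → ℕ} {s : List σ}
    {kind p : ℕ} (h : PointsTo docs ptr s kind p) : kind ≤ 1 := by
  rcases h with ⟨-, rfl, -⟩ | ⟨-, rfl, -⟩ <;> simp

theorem PointsTo.lt {docs : Fin β → List σ} {ptr : List (σ ⊕ Fin β) → ℕ} {s : List σ}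
    {kind p N : ℕ} (h : PointsTo docs ptr s kind p)
    (hN : Set.BijOn ptr {x | IsExplicit docs x} (Set.Iio N)) : p < N := by
  rcases h with ⟨h, -, rfl⟩ | ⟨-, -, u, v, hv, -, -, rfl⟩
  · exact hN.mapsTo h
  · exact hN.mapsTo hv.2.1

/-- Two strings with the same pointer to an edge: no explicit node lies between them. -/
theorem PointsTo.not_explicit_between {docs : Fin β → List σ} {ptr : List (σ ⊕ Fin β) → ℕ}
    {s₁ s₂ : List σ} {p : ℕ} (hptr : Set.InjOn ptr {x | IsExplicit docs x})
    (h₁ : PointsTo docs ptr s₁ 1 p) (h₂ : PointsTo docs ptr s₂ 1 p)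
    (hle : s₁.length ≤ s₂.length) :
    s₁ <+: s₂ ∧ ∀ y, IsExplicit docs y → s₁.map Sum.inl <+: y → y <+: s₂.map Sum.inl → False := by
  obtain ⟨-, h, -⟩ | ⟨hx₁, -, u₁, v₁, he₁, hu₁, hv₁, rfl⟩ := h₁
  · omega
  obtain ⟨-, h, -⟩ | ⟨hx₂, -, u₂, v₂, he₂, hu₂, hv₂, hp⟩ := h₂
  · omega
  obtain rfl := hptr he₁.2.1 he₂.2.1 hp
  have hpre := List.prefix_of_prefix_length_le hv₁ hv₂ (by simpa using hle)
  refine ⟨by simpa only [filterMap_getLeft_map_inl] using hpre.filterMap Sum.getLeft?, ?_⟩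
  intro y hy h1 h2
  rcases he₁.2.2.2.2 y hy (hu₁.trans h1) (h2.trans hv₂) with rfl | rfl
  · exact hx₁ (h1.eq_of_length_le hu₁.length_le ▸ hy)
  · exact hx₂ (h2.eq_of_length_le hv₂.length_le ▸ hy)

/-- In a suitable collection `X` of substrings of `w`, pointers in the tree of the documents determine
pointers in the suffix tree of `w`. -/
theorem exists_pointsTo_of_pointsTo {docs : Fin β → List σ} {w : List σ}
    {ptr : List (σ ⊕ Fin β) → ℕ} (ptr' : List (σ ⊕ Fin 1) → ℕ) (X : Set (List σ))
    (hptr : Set.InjOn ptr {x | IsExplicit docs x})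
    (hX : ∀ s ∈ X, s <:+: w)
    (hcov : ∀ s₁ ∈ X, ∀ s₂ ∈ X, s₁.length < s₂.length →
      ∀ r, r <:+: w → r.length ≤ s₂.length + 1 → ∃ k, r <:+: docs k)
    (hlast : ∃ k, ∀ s ∈ X, ∀ r, r <:+ w → r.length ≤ s.length → r <:+ docs k)
    {kind p : ℕ} (hne : ∃ s ∈ X, PointsTo docs ptr s kind p) :
    ∃ kind' p', (∃ s, PointsTo (fun _ : Fin 1 => w) ptr' s kind' p') ∧
      ∀ s ∈ X, PointsTo docs ptr s kind p → PointsTo (fun _ : Fin 1 => w) ptr' s kind' p' := by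
  classical
  -- The longest string with the given pointer determines the table entry.
  obtain ⟨s₂, ⟨hs₂, hp₂⟩, hmax⟩ : ∃ s, (s ∈ X ∧ PointsTo docs ptr s kind p) ∧
      ∀ s', (s' ∈ X ∧ PointsTo docs ptr s' kind p) → s'.length ≤ s.length := by
    have hex : ∃ m, ∃ s, (s ∈ X ∧ PointsTo docs ptr s kind p) ∧ s.length + m = w.length := by
      obtain ⟨s, hs, hp⟩ := hne
      exact ⟨w.length - s.length, s, ⟨hs, hp⟩, by have := (hX s hs).length_le; omega⟩
    obtain ⟨s, hs, hl⟩ := Nat.find_spec hex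
    refine ⟨s, hs, fun s' hs' => ?_⟩
    have h1 := (hX s' hs'.1).length_le
    have h2 := Nat.find_min' hex (m := w.length - s'.length) ⟨s', hs', by omega⟩
    omega
  obtain ⟨kind', p', hq⟩ := (isNode_map_inl (docs := fun _ : Fin 1 => w) (i := 0)
    (hX s₂ hs₂)).exists_pointsTo ptr'
  refine ⟨kind', p', ⟨s₂, hq⟩, fun s₁ hs₁ hp₁ => ?_⟩
  by_cases h12 : s₁ = s₂
  · rwa [h12]
  have hle := hmax s₁ ⟨hs₁, hp₁⟩
  have hk : kind = 0 ∨ kind = 1 := by have := hp₁.kind_le; omega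
  rcases hk with rfl | rfl
  · obtain ⟨h1, -, e1⟩ | ⟨-, h, -⟩ := hp₁
    · obtain ⟨h2, -, e2⟩ | ⟨-, h, -⟩ := hp₂
      · have := hptr h1 h2 (e1.symm.trans e2)
        exact absurd (List.map_injective_iff.2 Sum.inl_injective this) h12
      · omega
    · omega
  · obtain ⟨hpre, hbet⟩ := PointsTo.not_explicit_between hptr hp₁ hp₂ hle
    have hlt : s₁.length < s₂.length :=
      lt_of_le_of_ne hle fun h => h12 (hpre.eq_of_length h)
    -- An explicit node of the tree of `w` between `s₁` and `s₂` would remain explicit in the tree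
    -- of the documents, inside an edge.
    have hnot : ∀ y, IsExplicit (fun _ : Fin 1 => w) y → s₁.map Sum.inl <+: y →
        y <+: s₂.map Sum.inl → False := by
      intro y hy h1 h2
      obtain ⟨s, hs, rfl⟩ : ∃ s, s <+: s₂ ∧ y = s.map Sum.inl := by
        obtain ⟨z, hz⟩ := h2
        obtain ⟨l₁, l₂, e, e1, -⟩ := List.map_eq_append_iff.1 hz.symm
        exact ⟨l₁, ⟨l₂, e.symm⟩, e1.symm⟩
      have hle2 := hs.length_le
      obtain ⟨k, hk⟩ := hlast
      refine hbet (s.map Sum.inl) (IsExplicit.of_cover (w := w)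
        (fun r hr hl => hcov s₁ hs₁ s₂ hs₂ hlt r hr (by omega))
        ⟨k, fun r hr hl => hk s₂ hs₂ r hr (by omega)⟩ hy) ?_ ?_
      · have h3 := h1.filterMap Sum.getLeft?
        simp only [filterMap_getLeft_map_inl] at h3
        exact h3.map _
      · exact hs.map _
    have hpre' : s₁.map (Sum.inl : σ → σ ⊕ Fin 1) <+: s₂.map Sum.inl := hpre.map _
    obtain ⟨h, -⟩ | ⟨-, rfl, u, v, he, hu, hv, rfl⟩ := hq
    · exact (hnot _ h hpre' List.prefix_rfl).elim
    · refine Or.inr ⟨fun h => hnot _ h List.prefix_rfl hpre', rfl, u, v, he, ?_, hpre'.trans hv, rfl⟩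
      rcases List.prefix_or_prefix_of_prefix hu hpre' with h | h
      · exact h
      · exact (hnot u he.1 h hu).elim

end Nodes

/-! ### The number of explicit nodes -/

/-- The branching nodes of the trie of a set of strings. -/
def branchings {α : Type*} (L : Set (List α)) : Set (List α) :=
  {x | ∃ a b, a ≠ b ∧ (∃ y ∈ L, x ++ [a] <+: y) ∧ ∃ y ∈ L, x ++ [b] <+: y}

theorem append_singleton_prefix_of_prefix {α : Type*} {x₁ x₂ y : List α} {a : α}
    (h₁ : x₁ ++ [a] <+: y) (h₂ : x₂ <+: y) (hlt : x₁.length < x₂.length) : x₁ ++ [a] <+: x₂ :=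
  List.prefix_of_prefix_length_le h₁ h₂ (by simpa using hlt)

/-- Adding a string creates at most one new branching node. -/
theorem branchings_insert_subsingleton {α : Type*} (L : Set (List α)) (y : List α) :
    (branchings (insert y L) \ branchings L).Subsingleton := by
  have key : ∀ x ∈ branchings (insert y L) \ branchings L,
      ∃ a b, a ≠ b ∧ x ++ [a] <+: y ∧ ∃ z ∈ L, x ++ [b] <+: z := by
    rintro x ⟨⟨a, b, hab, ⟨y₁, h1, h2⟩, y₂, h3, h4⟩, hn⟩
    rcases h1 with rfl | h1
    · rcases h3 with rfl | h3
      · have := (List.prefix_of_prefix_length_le h2 h4 (by simp)).eq_of_length (by simp)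
        exact absurd (by simpa using this) hab
      · exact ⟨a, b, hab, h2, y₂, h3, h4⟩
    · rcases h3 with rfl | h3
      · exact ⟨b, a, hab.symm, h4, y₁, h1, h2⟩
      · exact absurd ⟨a, b, hab, ⟨y₁, h1, h2⟩, y₂, h3, h4⟩ hn
  have lt : ∀ x₁ ∈ branchings (insert y L) \ branchings L,
      ∀ x₂ ∈ branchings (insert y L) \ branchings L, ¬ x₁.length < x₂.length := by
    intro x₁ h₁ x₂ h₂ hlt
    obtain ⟨a, b, hab, ha, z, hz, hb⟩ := key x₁ h₁
    obtain ⟨a', b', -, ha', z', hz', hb'⟩ := key x₂ h₂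
    -- The deeper node `x₂` already has a string of `L` below it, so `L` alone continues `x₁` with
    -- both `a` and `b`.
    have h := append_singleton_prefix_of_prefix ha ((List.prefix_append _ _).trans ha') hlt
    exact h₁.2 ⟨a, b, hab, ⟨z', hz', h.trans ((List.prefix_append _ _).trans hb')⟩, z, hz, hb⟩
  intro x₁ h₁ x₂ h₂
  obtain ⟨a, -, -, ha, -⟩ := key x₁ h₁
  obtain ⟨a', -, -, ha', -⟩ := key x₂ h₂
  have hl : x₁.length = x₂.length := by have := lt x₁ h₁ x₂ h₂; have := lt x₂ h₂ x₁ h₁; omega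
  exact (List.prefix_of_prefix_length_le ((List.prefix_append _ _).trans ha)
    ((List.prefix_append _ _).trans ha') hl.le).eq_of_length hl

theorem encard_branchings_le {α : Type*} (L : Finset (List α)) :
    (branchings (L : Set (List α))).encard ≤ L.card := by
  classical
  induction L using Finset.induction_on with
  | empty => simp [branchings]
  | insert y L hy ih =>
    rw [Finset.coe_insert, Finset.card_insert_of_notMem hy]
    calc (branchings (insert y (L : Set (List α)))).encard
        ≤ (branchings (L : Set (List α)) ∪
            (branchings (insert y (L : Set (List α))) \ branchings L)).encard :=
          Set.encard_le_encard fun x hx => by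
            by_cases h : x ∈ branchings (L : Set (List α))
            · exact Or.inl h
            · exact Or.inr ⟨hx, h⟩
      _ ≤ _ := Set.encard_union_le _ _
      _ ≤ L.card + 1 := add_le_add ih
          (Set.encard_le_one_iff_subsingleton.2 (branchings_insert_subsingleton _ _))
      _ = _ := by push_cast; rfl

/-- Apart from the root, an explicit node is a leaf, hence a suffix of a terminated document, or a
branching node of the set of these suffixes. A document contributes `m + 2` suffixes, including the
empty one. -/
theorem encard_explicit_le {σ : Type*} {β : ℕ} (docs : Fin β → List σ) {m : ℕ}
    (hm : ∀ i, (docs i).length = m) :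
    {x | IsExplicit docs x}.encard ≤ ((1 + 2 * (β * (m + 2)) : ℕ) : ℕ∞) := by
  classical
  set L : Finset (List (σ ⊕ Fin β)) :=
    Finset.univ.biUnion fun i => (terminated docs i).tails.toFinset with hL
  have mem : ∀ y, y ∈ L ↔ ∃ i, y <:+ terminated docs i := by simp [hL]
  have hcard : L.card ≤ β * (m + 2) := by
    refine Finset.card_biUnion_le.trans ?_
    refine (Finset.sum_le_card_nsmul _ _ (m + 2) fun i _ => ?_).trans (by simp)
    refine (List.toFinset_card_le _).trans ?_
    simp [terminated, hm]
  have hsub : {x | IsExplicit docs x} ⊆ {[]} ∪ (↑L ∪ branchings (L : Set _)) := by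
    rintro x ⟨⟨i, y, hy, hxy⟩, h | h | ⟨a, b, hab, ⟨i₁, y₁, h1, h2⟩, i₂, y₂, h3, h4⟩⟩
    · exact Or.inl h
    · refine Or.inr (Or.inl ?_)
      obtain ⟨z, rfl⟩ := hxy
      cases z with
      | nil => exact (mem _).2 ⟨i, by simpa using hy⟩
      | cons a z => exact absurd ⟨a, i, _, hy, ⟨z, by simp⟩⟩ h
    · exact Or.inr (Or.inr ⟨a, b, hab, ⟨y₁, (mem _).2 ⟨i₁, h1⟩, h2⟩, y₂, (mem _).2 ⟨i₂, h3⟩, h4⟩)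
  calc {x | IsExplicit docs x}.encard
      ≤ ({[]} ∪ (↑L ∪ branchings (L : Set _))).encard := Set.encard_le_encard hsub
    _ ≤ Set.encard {[]} + (Set.encard (L : Set (List (σ ⊕ Fin β))) +
          (branchings (L : Set (List (σ ⊕ Fin β)))).encard) :=
        (Set.encard_union_le _ _).trans (add_le_add le_rfl (Set.encard_union_le _ _))
    _ ≤ 1 + (L.card + L.card) := by
        rw [Set.encard_singleton, Set.encard_coe_eq_coe_finsetCard]
        exact add_le_add le_rfl (add_le_add le_rfl (encard_branchings_le L))
    _ ≤ _ := by
        rw [← Nat.cast_add, ← Nat.cast_one, ← Nat.cast_add, Nat.cast_le]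
        omega

theorem pointer_bound {σ : Type*} {β : ℕ} {docs : Fin β → List σ} {m N : ℕ}
    {ptr : List (σ ⊕ Fin β) → ℕ} (hm : ∀ i, (docs i).length = m)
    (hN : Set.BijOn ptr {x | IsExplicit docs x} (Set.Iio N)) : N ≤ 1 + 2 * (β * (m + 2)) := by
  have h1 := encard_explicit_le docs hm
  rw [← hN.injOn.encard_image, hN.image_eq] at h1
  rw [← Nat.cast_le (α := ℕ∞)]
  refine le_trans ?_ h1
  rw [← Finset.coe_Iio, Set.encard_coe_eq_coe_finsetCard, Nat.card_Iio]

/-- The long substring structures require some numbering of their trees; any one will do, as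
pointers are translated afterwards. -/
theorem exists_isPointerMap {σ : Type*} {β : ℕ} (docs : Fin β → List σ) {m : ℕ}
    (hm : ∀ i, (docs i).length = m) : ∃ ptr, IsPointerMap docs ptr := by
  have hfin : {x | IsExplicit docs x}.Finite :=
    Set.finite_of_encard_le_coe (encard_explicit_le docs hm)
  have := hfin.to_subtype
  obtain ⟨f, hf⟩ : ∃ f : List (σ ⊕ Fin β) → ℕ, Set.BijOn f {x | IsExplicit docs x}
      (Set.Iio (Nat.card {x | IsExplicit docs x})) := by
    classical
    have e := Finite.equivFin {x | IsExplicit docs x}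
    refine ⟨fun x => if h : IsExplicit docs x then (e ⟨x, h⟩ : ℕ) else 0, ?_, ?_, ?_⟩
    · intro x hx
      have hx' : IsExplicit docs x := hx
      simp only [hx', dif_pos]
      exact (e ⟨x, hx⟩).2
    · intro x hx y hy h
      have hx' : IsExplicit docs x := hx
      have hy' : IsExplicit docs y := hy
      simp only [hx', hy', dif_pos] at h
      simpa using e.injective (Fin.ext h)
    · intro k hk
      refine ⟨e.symm ⟨k, hk⟩, (e.symm ⟨k, hk⟩).2, ?_⟩
      have : IsExplicit docs (e.symm ⟨k, hk⟩ : List (σ ⊕ Fin β)) := (e.symm ⟨k, hk⟩).2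
      simp only [this, dif_pos]
      exact congrArg Fin.val (e.apply_symm_apply ⟨k, hk⟩)
  exact ⟨f, _, hf⟩

/-! ### Runs of programs -/

theorem step_of_getElem? {W : ℕ} {P : List Instr} {D : List ℕ} {s : Config} {ins : Instr}
    (h : P[s.pc]? = some ins) : step W P D s = ins.exec W D s := by
  simp [step, h]

theorem step_of_length_le {W : ℕ} {P : List Instr} {D : List ℕ} {s : Config}
    (h : P.length ≤ s.pc) : step W P D s = s := by
  simp [step, List.getElem?_eq_none h]

/-- This lets a running time that depends on the query be rounded up to a common bound. -/
theorem iterate_step_of_halted {W : ℕ} {P : List Instr} {D : List ℕ} {s : Config} {k T : ℕ}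
    (hk : k ≤ T) (h : P.length ≤ ((step W P D)^[k] s).pc) :
    (step W P D)^[T] s = (step W P D)^[k] s := by
  obtain ⟨m, rfl⟩ := Nat.exists_eq_add_of_le' hk
  rw [Function.iterate_add_apply]
  exact Function.iterate_fixed (step_of_length_le h) m

/-- Instructions other than jumps. -/
def Instr.IsStraight : Instr → Prop
  | .jumpLt _ _ _ => False
  | _ => True

theorem Instr.IsStraight.pc_exec {ins : Instr} (h : ins.IsStraight) (W : ℕ) (D : List ℕ)
    (s : Config) : (ins.exec W D s).pc = s.pc + 1 := by
  cases ins <;> simp_all [Instr.IsStraight, Instr.exec]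

/-- A block of straight-line code is executed instruction by instruction. -/
theorem iterate_step_straight {W : ℕ} {D : List ℕ} (code : List Instr)
    (hcode : ∀ ins ∈ code, ins.IsStraight) (pre post : List Instr) (s : Config)
    (hs : s.pc = pre.length) :
    (step W (pre ++ code ++ post) D)^[code.length] s =
      code.foldl (fun s ins => ins.exec W D s) s := by
  induction code generalizing pre s with
  | nil => rfl
  | cons ins code ih =>
    rw [List.length_cons, Function.iterate_succ_apply, List.foldl_cons,
      step_of_getElem? (ins := ins) (by rw [hs]; simp)]
    have := ih (fun i hi => hcode i (List.mem_cons_of_mem _ hi)) (pre ++ [ins])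
      (ins.exec W D s) (by rw [(hcode ins List.mem_cons_self).pc_exec, hs]; simp)
    simpa using this

theorem pc_foldl_straight {W : ℕ} {D : List ℕ} (code : List Instr)
    (hcode : ∀ ins ∈ code, ins.IsStraight) (s : Config) :
    (code.foldl (fun s ins => ins.exec W D s) s).pc = s.pc + code.length := by
  induction code generalizing s with
  | nil => rfl
  | cons ins code ih =>
    rw [List.foldl_cons, ih (fun i hi => hcode i (List.mem_cons_of_mem _ hi)),
      (hcode ins List.mem_cons_self).pc_exec, List.length_cons]
    omega

/-! ### Simulating a program with shorter words on a memory segment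

The simulating program keeps register `r` of the simulated one in register `r + 10`. Register `3`
contains `2 ^ W'` for the word length `W'` of the simulated machine, registers `4` and `5` contain the
start and the length of the memory segment, registers `6` and `7` are left alone. -/

/-- The code that simulates one instruction, if placed at address `q`; `tgt` translates jump
targets. -/
def simBlock (tgt : ℕ → ℕ) (q : ℕ) : Instr → List Instr
  | .const d c =>
    [.const (d + 10) c, .binop .mod (d + 10) (d + 10) 3, .const 0 0, .const 0 0, .const 0 0]
  | .binop o d a b =>
    [.binop o (d + 10) (a + 10) (b + 10), .binop .mod (d + 10) (d + 10) 3,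
      .const 0 0, .const 0 0, .const 0 0]
  | .load d a =>
    [.binop .add 0 (a + 10) 4, .load 0 0, .jumpLt (a + 10) 5 (q + 4), .const 0 0,
      .binop .mod (d + 10) 0 3]
  | .jumpLt a b t =>
    [.jumpLt (a + 10) (b + 10) (tgt t), .const 0 0, .const 0 0, .const 0 0, .const 0 0]

/-- The code that simulates a program, if placed at address `q`. -/
def simCode (tgt : ℕ → ℕ) : ℕ → List Instr → List Instr
  | _, [] => []
  | q, ins :: P => simBlock tgt q ins ++ simCode tgt (q + 5) P

-- Blocks are padded to equal length so that instruction `t` is translated to address `q + 5 * t`.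
@[simp]
theorem length_simBlock (tgt : ℕ → ℕ) (q : ℕ) (ins : Instr) : (simBlock tgt q ins).length = 5 := by
  cases ins <;> rfl

@[simp]
theorem length_simCode (tgt : ℕ → ℕ) (q : ℕ) (P : List Instr) :
    (simCode tgt q P).length = 5 * P.length := by
  induction P generalizing q with
  | nil => rfl
  | cons ins P ih => simp [simCode, ih]; ring

theorem simCode_append (tgt : ℕ → ℕ) (q : ℕ) (P₁ P₂ : List Instr) :
    simCode tgt q (P₁ ++ P₂) = simCode tgt q P₁ ++ simCode tgt (q + 5 * P₁.length) P₂ := by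
  induction P₁ generalizing q with
  | nil => rfl
  | cons ins P ih =>
    simp only [List.cons_append, simCode, ih, List.append_assoc, List.length_cons]
    rw [show q + 5 + 5 * P.length = q + 5 * (P.length + 1) by ring]

theorem WordOp.eval_lt {W : ℕ} (o : WordOp) {a b : ℕ} (ha : a < 2 ^ W) (hb : b < 2 ^ W) :
    o.eval W a b < 2 ^ W := by
  have hpos : 0 < 2 ^ W := by positivity
  cases o
  case add | sub | mul | shl => exact Nat.mod_lt _ hpos
  case div => exact (Nat.div_le_self _ _).trans_lt ha
  case mod => exact (Nat.mod_le _ _).trans_lt ha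
  case and => exact Nat.and_lt_two_pow _ hb
  case or => exact Nat.or_lt_two_pow ha hb
  case xor => exact Nat.xor_lt_two_pow ha hb
  case shr => exact (Nat.div_le_self _ _).trans_lt ha

/-- Addition, subtraction, multiplication and left shift are compatible with reduction modulo `2 ^
W'`, a divisor of `2 ^ W`; the other operations do not leave the range of short words. -/
theorem WordOp.eval_mod {W W' : ℕ} (hW : W' ≤ W) (o : WordOp) {a b : ℕ} (ha : a < 2 ^ W')
    (hb : b < 2 ^ W') : o.eval W a b % 2 ^ W' = o.eval W' a b := by
  have hdvd : 2 ^ W' ∣ 2 ^ W := pow_dvd_pow 2 hW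
  have key := o.eval_lt ha hb
  cases o
  case add | mul | shl => exact Nat.mod_mod_of_dvd _ hdvd
  case sub =>
    simp only [WordOp.eval]
    rw [Nat.mod_mod_of_dvd _ hdvd]
    obtain ⟨c, hc⟩ := hdvd
    have hle : 2 ^ W' ≤ 2 ^ W := Nat.pow_le_pow_right (by norm_num) hW
    have hc1 : 1 ≤ c := by
      rcases Nat.eq_zero_or_pos c with rfl | h
      · simp at hc
      · exact h
    obtain ⟨e, rfl⟩ := Nat.exists_eq_add_of_le' hc1
    rw [hc, show a + (2 ^ W' * (e + 1) - b) = a + (2 ^ W' - b) + 2 ^ W' * e by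
      rw [Nat.mul_add, Nat.mul_one]; omega, Nat.add_mul_mod_self_left]
  case div | mod | and | or | xor | shr => exact Nat.mod_eq_of_lt key

/-- The state `s'` of a simulating program, whose simulating code starts at address `q`, represents
the state `s` of a simulated program of length `len`. -/
structure Simulates (W' q len : ℕ) (env : ℕ → ℕ) (s s' : Config) : Prop where
  pc : s'.pc = q + 5 * min s.pc len
  reg : ∀ r, s'.reg (r + 10) = s.reg r
  lt : ∀ r, s.reg r < 2 ^ W'
  env : ∀ r, 3 ≤ r → r < 8 → s'.reg r = env r

/-- Only cells of `D'` with addresses below `2 ^ W'` can be read, so by `hout` the segment may be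
shorter than `D'` if it contains all of these that are nonzero. -/
theorem Simulates.step {W W' : ℕ} (hW : W' ≤ W) {P pre post : List Instr} {D D' : List ℕ}
    {env : ℕ → ℕ} {s s' : Config} (henv : env 3 = 2 ^ W')
    (hlt : ∀ a, D'.getD a 0 < 2 ^ W')
    (hin : ∀ a < env 5, a + env 4 < 2 ^ W ∧ D.getD (a + env 4) 0 = D'.getD a 0)
    (hout : ∀ a, env 5 ≤ a → a < 2 ^ W' → D'.getD a 0 = 0)
    (h : Simulates W' pre.length P.length env s s') :
    ∃ k ≤ 5, Simulates W' pre.length P.length env (step W' P D' s)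
      ((step W (pre ++ simCode (fun t => pre.length + 5 * min t P.length) pre.length P ++ post)
        D)^[k] s') := by
  rcases Nat.lt_or_ge s.pc P.length with hpc | hpc
  swap
  · rw [step_of_length_le hpc]
    exact ⟨0, by simp, h⟩
  set tgt : ℕ → ℕ := fun t => pre.length + 5 * min t P.length with htgt
  obtain ⟨P₁, ins, P₂, rfl, hP₁⟩ : ∃ P₁ ins P₂, P = P₁ ++ ins :: P₂ ∧ P₁.length = s.pc :=
    ⟨P.take s.pc, P[s.pc], P.drop (s.pc + 1), by simp, by simp; omega⟩
  rw [step_of_getElem? (ins := ins) (by simp [← hP₁])]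
  set q := pre.length + 5 * P₁.length with hq
  obtain ⟨pre', post', hpre', hprog⟩ : ∃ pre' post' : List Instr, pre'.length = q ∧
      pre ++ simCode tgt pre.length (P₁ ++ ins :: P₂) ++ post =
        pre' ++ simBlock tgt q ins ++ post' :=
    ⟨pre ++ simCode tgt pre.length P₁, simCode tgt (q + 5) P₂ ++ post, by simp [hq],
      by simp [simCode_append, simCode, hq]⟩
  rw [hprog]
  have hs' : s'.pc = q := by rw [h.pc, hq, hP₁, min_eq_left hpc.le]
  have hmin : min (s.pc + 1) (P₁ ++ ins :: P₂).length = s.pc + 1 := min_eq_left hpc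
  have hdvd : 2 ^ W' ∣ 2 ^ W := pow_dvd_pow 2 hW
  have h3 := (h.env 3 (by norm_num) (by norm_num)).trans henv
  have h4 := h.env 4 (by norm_num) (by norm_num)
  have h5 := h.env 5 (by norm_num) (by norm_num)
  -- Writing the right value into register `d + 10` suffices for the instructions without jumps.
  have fin : ∀ (d v : ℕ) (s₂ : Config), v < 2 ^ W' → s₂.pc = q + 5 →
      (∀ r, 3 ≤ r → s₂.reg r = if r = d + 10 then v else s'.reg r) →
      Simulates W' pre.length (P₁ ++ ins :: P₂).length env
        ⟨s.pc + 1, Function.update s.reg d v⟩ s₂ := by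
    intro d v s₂ hv hpc₂ hreg
    refine ⟨?_, fun r => ?_, fun r => ?_, fun r hr1 hr2 => ?_⟩
    · rw [hpc₂, hq, hP₁]; simp only [hmin]; ring
    · rw [hreg _ (by omega)]
      simp only [Function.update_apply, Nat.add_right_cancel_iff, h.reg]
    · simp only [Function.update_apply]; split
      · exact hv
      · exact h.lt r
    · rw [hreg _ hr1, if_neg (by omega)]; exact h.env r hr1 hr2
  cases ins with
  | const d c =>
    refine ⟨5, le_rfl, ?_⟩
    have := iterate_step_straight (W := W) (D := D) (simBlock tgt q (.const d c))
      (by simp [simBlock, Instr.IsStraight]) pre' post' s' (by rw [hs', hpre'])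
    rw [length_simBlock] at this
    rw [this]
    refine fin d _ _ (Nat.mod_lt _ (by positivity)) ?_ ?_
    · rw [pc_foldl_straight _ (by simp [simBlock, Instr.IsStraight]), hs', length_simBlock]
    · intro r hr
      have : r ≠ 0 := by omega
      simp only [simBlock, List.foldl_cons, List.foldl_nil, Instr.exec, Function.update_apply,
        WordOp.eval, this, if_false, if_true]
      split
      · rw [if_neg (by omega), h3, Nat.mod_mod_of_dvd _ hdvd]
      · rfl
  | binop o d a b =>
    refine ⟨5, le_rfl, ?_⟩
    have := iterate_step_straight (W := W) (D := D) (simBlock tgt q (.binop o d a b))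
      (by simp [simBlock, Instr.IsStraight]) pre' post' s' (by rw [hs', hpre'])
    rw [length_simBlock] at this
    rw [this]
    refine fin d _ _ (o.eval_lt (h.lt a) (h.lt b)) ?_ ?_
    · rw [pc_foldl_straight _ (by simp [simBlock, Instr.IsStraight]), hs', length_simBlock]
    · intro r hr
      have : r ≠ 0 := by omega
      simp only [simBlock, List.foldl_cons, List.foldl_nil, Instr.exec, Function.update_apply,
        this, if_false]
      split
      · rw [← o.eval_mod hW (h.lt a) (h.lt b), ← h.reg, ← h.reg]
        simp only [WordOp.eval, if_true]
        rw [if_neg (by omega), h3]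
      · rfl
  | load d a =>
    have hget : ∀ r < 5, (pre' ++ simBlock tgt q (.load d a) ++ post')[q + r]? =
        (simBlock tgt q (.load d a))[r]? := by
      intro r hr
      rw [List.getElem?_append_left (by simp [hpre', hr]),
        List.getElem?_append_right (by omega), hpre', Nat.add_sub_cancel_left]
    set Q := pre' ++ simBlock tgt q (.load d a) ++ post' with hQ
    have st : ∀ r < 5, ∀ ins reg, (simBlock tgt q (.load d a))[r]? = some ins →
        SubstringRetrieval.step W Q D ⟨q + r, reg⟩ = ins.exec W D ⟨q + r, reg⟩ :=
      fun r hr ins reg hi => step_of_getElem? ((hget r hr).trans hi)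
    have hs'' : s' = ⟨q + 0, s'.reg⟩ := by rw [← hs', Nat.add_zero]
    set x := D.getD ((s.reg a + env 4) % 2 ^ W) 0 with hx
    have e1 : (SubstringRetrieval.step W Q D)^[2] s' =
        ⟨q + 2, Function.update s'.reg 0 x⟩ := by
      change SubstringRetrieval.step W Q D (SubstringRetrieval.step W Q D s') = _
      nth_rewrite 1 [hs'']
      rw [st 0 (by norm_num) (.binop .add 0 (a + 10) 4) _ rfl]
      refine (st 1 (by norm_num) (.load 0 0) _ rfl).trans ?_
      simp only [Instr.exec, WordOp.eval, Function.update_self, Function.update_idem, h.reg, h4, hx]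
    have e2 : ∀ v, (Function.update s'.reg 0 v) (a + 10) = s.reg a := fun v => by
      rw [Function.update_of_ne (by omega), h.reg]
    have e3 : ∀ v, (Function.update s'.reg 0 v) 5 = env 5 := fun v => by
      rw [Function.update_of_ne (by omega), h5]
    -- The state before the final move.
    obtain ⟨k, hk, v, hv, hrun⟩ : ∃ k ≤ 4, ∃ v, v % 2 ^ W' = D'.getD (s.reg a) 0 ∧
        (SubstringRetrieval.step W Q D)^[k] s' = ⟨q + 4, Function.update s'.reg 0 v⟩ := by
      by_cases hlt' : s.reg a < env 5
      · refine ⟨3, by norm_num, x, ?_, ?_⟩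
        · obtain ⟨h1, h2⟩ := hin _ hlt'
          rw [hx, Nat.mod_eq_of_lt h1, h2, Nat.mod_eq_of_lt (hlt _)]
        · rw [Function.iterate_succ_apply', e1,
            st 2 (by norm_num) (.jumpLt (a + 10) 5 (q + 4)) _ rfl]
          simp only [Instr.exec, e2, e3, hlt', if_true]
      -- Beyond the segment, the word just loaded is foreign data and is overwritten by `0`.
      · refine ⟨4, le_rfl, 0, ?_, ?_⟩
        · rw [Nat.zero_mod, hout _ (not_lt.1 hlt') (h.lt a)]
        · rw [Function.iterate_succ_apply', Function.iterate_succ_apply', e1,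
            st 2 (by norm_num) (.jumpLt (a + 10) 5 (q + 4)) _ rfl]
          simp only [Instr.exec, e2, e3, hlt', if_false]
          refine (st 3 (by norm_num) (.const 0 0) _ rfl).trans ?_
          simp only [Instr.exec, Function.update_idem, Nat.zero_mod]
    refine ⟨k + 1, by omega, ?_⟩
    rw [Function.iterate_succ_apply', hrun,
      st 4 (by norm_num) (.binop .mod (d + 10) 0 3) _ rfl]
    refine fin d _ _ (hlt _) rfl ?_
    intro r hr
    simp only [Instr.exec, WordOp.eval, Function.update_self]
    rw [Function.update_apply, Function.update_of_ne (by omega), Function.update_of_ne (by omega),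
      h3, hv]
  | jumpLt a b t =>
    by_cases hab : s.reg a < s.reg b
    · refine ⟨1, by norm_num, ?_⟩
      rw [Function.iterate_one, step_of_getElem? (ins := .jumpLt (a + 10) (b + 10) (tgt t))
        (by rw [hs', ← hpre']; simp [simBlock])]
      refine ⟨?_, fun r => h.reg r, fun r => h.lt r, fun r => h.env r⟩
      simp [Instr.exec, h.reg, hab, htgt]
    · refine ⟨5, le_rfl, ?_⟩
      rw [Function.iterate_succ_apply, step_of_getElem? (ins := .jumpLt (a + 10) (b + 10) (tgt t))
        (by rw [hs', ← hpre']; simp [simBlock])]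
      set nops : List Instr := [.const 0 0, .const 0 0, .const 0 0, .const 0 0] with hnops
      have hst : ∀ i ∈ nops, i.IsStraight := by simp [hnops, Instr.IsStraight]
      have := iterate_step_straight (W := W) (D := D) nops hst
        (pre' ++ [.jumpLt (a + 10) (b + 10) (tgt t)]) post'
        (Instr.exec W D s' (.jumpLt (a + 10) (b + 10) (tgt t)))
        (by simp [Instr.exec, h.reg, hab, hs', hpre'])
      rw [show pre' ++ [Instr.jumpLt (a + 10) (b + 10) (tgt t)] ++ nops ++ post' =
        pre' ++ simBlock tgt q (.jumpLt a b t) ++ post' by simp [simBlock, hnops]] at this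
      rw [show nops.length = 4 from rfl] at this
      rw [this]
      have hreg : ∀ r, 3 ≤ r → (nops.foldl (fun s ins => ins.exec W D s)
          (Instr.exec W D s' (.jumpLt (a + 10) (b + 10) (tgt t)))).reg r = s'.reg r := by
        intro r hr
        have : r ≠ 0 := by omega
        simp [hnops, Instr.exec, this]
      refine ⟨?_, fun r => ?_, fun r => h.lt r, fun r hr1 hr2 => ?_⟩
      · rw [pc_foldl_straight _ hst]
        simp only [Instr.exec, h.reg, hab, if_false, hs', hmin, hnops, List.length_cons,
          List.length_nil, hq, hP₁]
        ring
      · rw [hreg _ (by omega), h.reg]; rfl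
      · rw [hreg _ hr1, h.env r hr1 hr2]

theorem Simulates.iterate {W W' : ℕ} (hW : W' ≤ W) {P pre post : List Instr} {D D' : List ℕ}
    {env : ℕ → ℕ} {s s' : Config} (henv : env 3 = 2 ^ W')
    (hlt : ∀ a, D'.getD a 0 < 2 ^ W')
    (hin : ∀ a < env 5, a + env 4 < 2 ^ W ∧ D.getD (a + env 4) 0 = D'.getD a 0)
    (hout : ∀ a, env 5 ≤ a → a < 2 ^ W' → D'.getD a 0 = 0)
    (h : Simulates W' pre.length P.length env s s') (T : ℕ) :
    ∃ k ≤ 5 * T, Simulates W' pre.length P.length env ((SubstringRetrieval.step W' P D')^[T] s)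
      ((SubstringRetrieval.step W
        (pre ++ simCode (fun t => pre.length + 5 * min t P.length) pre.length P ++ post)
        D)^[k] s') := by
  induction T with
  | zero => exact ⟨0, le_rfl, h⟩
  | succ T ih =>
    obtain ⟨k, hk, hsim⟩ := ih
    obtain ⟨m, hm, hsim'⟩ := hsim.step (post := post) hW henv hlt hin hout
    refine ⟨m + k, by omega, ?_⟩
    rwa [Function.iterate_succ_apply', Function.iterate_add_apply]

/-! ### The query program for general substrings -/

/-- Finds the record of the query and copies it into the registers. -/
def queryPrologue : List Instr :=
  [.binop .sub 2 1 0, .load 9 2, .const 8 8, .binop .mul 8 0 8, .binop .add 9 9 8, .const 8 1,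
    .load 10 9, .binop .add 9 9 8, .load 11 9, .binop .add 12 11 2,
    .binop .add 9 9 8, .load 3 9, .binop .add 9 9 8, .load 4 9, .binop .add 9 9 8, .load 5 9,
    .binop .add 9 9 8, .load 6 9, .binop .add 9 9 8, .load 7 9]

/-- Translates the pointer found by the simulated program. -/
def queryEpilogue : List Instr :=
  [.binop .add 2 11 11, .binop .add 2 2 10, .binop .add 1 2 7, .load 1 1, .binop .add 0 2 6,
    .load 0 0]

def queryProgram (P : List Instr) : List Instr :=
  queryPrologue ++
    simCode (fun t => queryPrologue.length + 5 * min t P.length) queryPrologue.length P ++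
    queryEpilogue

/-- No address overflows, so the modular arithmetic is exact. Registers from `13` on are still `0`,
as the initial state of the simulated program demands. The record supplies `2 ^ W'` and the
addresses, since the program cannot depend on `n`. -/
theorem simulates_queryPrologue {W W' : ℕ} {len : ℕ} {D : List ℕ} {i j E k i' B Y T₁ T₂ : ℕ}
    {post : List Instr} (h8 : 8 < 2 ^ W) (hWW : W' ≤ W)
    (hij : i ≤ j) (hj : j < 2 ^ W)
    (hE : D.getD (j - i) 0 = E) (hEi : E + i * 8 + 8 ≤ 2 ^ W)
    (h0 : D.getD (E + i * 8) 0 = k) (h1 : D.getD (E + i * 8 + 1) 0 = i')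
    (h2 : D.getD (E + i * 8 + 2) 0 = 2 ^ W') (h3 : D.getD (E + i * 8 + 3) 0 = B)
    (h4 : D.getD (E + i * 8 + 4) 0 = Y) (h5 : D.getD (E + i * 8 + 5) 0 = T₁)
    (h6 : D.getD (E + i * 8 + 6) 0 = T₂)
    (hk : k < 2 ^ W') (hj' : i' + (j - i) < 2 ^ W') :
    Simulates W' queryPrologue.length len
      (fun r => if r = 3 then 2 ^ W' else if r = 4 then B else if r = 5 then Y else
        if r = 6 then T₁ else T₂)
      (initConfig [k, i', i' + (j - i)])
      ((step W (queryPrologue ++ post) D)^[queryPrologue.length] (initConfig [i, j])) := by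
  have hle : 2 ^ W' ≤ 2 ^ W := Nat.pow_le_pow_right (by norm_num) hWW
  have hst : ∀ ins ∈ queryPrologue, ins.IsStraight := by
    simp [queryPrologue, Instr.IsStraight]
  have hrun := iterate_step_straight (W := W) (D := D) queryPrologue hst [] post
    (initConfig [i, j]) rfl
  rw [List.nil_append] at hrun
  rw [hrun]
  have e0 : (j + (2 ^ W - i)) % 2 ^ W = j - i := by
    rw [show j + (2 ^ W - i) = j - i + 2 ^ W by omega, Nat.add_mod_right]
    exact Nat.mod_eq_of_lt (by omega)
  have e1 : 8 % 2 ^ W = 8 := Nat.mod_eq_of_lt h8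
  have e2 : 1 % 2 ^ W = 1 := Nat.mod_eq_of_lt (by omega)
  have e3 : (i * 8) % 2 ^ W = i * 8 := Nat.mod_eq_of_lt (by omega)
  have e4 : (E + i * 8) % 2 ^ W = E + i * 8 := Nat.mod_eq_of_lt (by omega)
  have e5 : (E + i * 8 + 1) % 2 ^ W = E + i * 8 + 1 := Nat.mod_eq_of_lt (by omega)
  have e6 : (E + i * 8 + 1 + 1) % 2 ^ W = E + i * 8 + 2 := Nat.mod_eq_of_lt (by omega)
  have e7 : (E + i * 8 + 2 + 1) % 2 ^ W = E + i * 8 + 3 := Nat.mod_eq_of_lt (by omega)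
  have e8 : (E + i * 8 + 3 + 1) % 2 ^ W = E + i * 8 + 4 := Nat.mod_eq_of_lt (by omega)
  have e9 : (E + i * 8 + 4 + 1) % 2 ^ W = E + i * 8 + 5 := Nat.mod_eq_of_lt (by omega)
  have e10 : (E + i * 8 + 5 + 1) % 2 ^ W = E + i * 8 + 6 := Nat.mod_eq_of_lt (by omega)
  have e11 : (i' + (j - i)) % 2 ^ W = i' + (j - i) := Nat.mod_eq_of_lt (by omega)
  set s := queryPrologue.foldl (fun s ins => ins.exec W D s) (initConfig [i, j]) with hs
  have hreg : ∀ r, s.reg r = if r = 7 then T₂ else if r = 9 then E + i * 8 + 6 else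
      if r = 6 then T₁ else if r = 5 then Y else if r = 4 then B else if r = 3 then 2 ^ W' else
      if r = 12 then i' + (j - i) else if r = 11 then i' else if r = 10 then k else
      if r = 8 then 1 else if r = 2 then j - i else [i, j].getD r 0 := by
    intro r
    simp only [hs, queryPrologue, List.foldl_cons, List.foldl_nil, Instr.exec, initConfig,
      WordOp.eval, Function.update_self, ne_eq, Nat.reduceEqDiff, OfNat.zero_ne_ofNat,
      not_false_eq_true, Function.update_of_ne,
      List.getD_cons_zero, List.getD_cons_succ,
      e0, e1, e2, e3, e4, e5, e6, e7, e8, e9, e10, e11, hE, h0, h1, h2, h3, h4, h5, h6]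
    simp only [Function.update_apply]
    clear_value s
    rcases Nat.lt_or_ge r 13 with hr | hr
    · interval_cases r <;> rfl
    · have hne : ∀ c < 13, r ≠ c := fun c hc => by omega
      simp only [hne _ (by norm_num : 2 < 13), hne _ (by norm_num : 3 < 13),
        hne _ (by norm_num : 4 < 13), hne _ (by norm_num : 5 < 13), hne _ (by norm_num : 6 < 13),
        hne _ (by norm_num : 7 < 13), hne _ (by norm_num : 8 < 13), hne _ (by norm_num : 9 < 13),
        hne _ (by norm_num : 10 < 13), hne _ (by norm_num : 11 < 13),
        hne _ (by norm_num : 12 < 13), if_false]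
  refine ⟨?_, fun r => ?_, fun r => ?_, fun r hr1 hr2 => ?_⟩
  · rw [hs, pc_foldl_straight _ hst]; simp [initConfig]
  · rw [hreg]
    rcases r with _ | _ | _ | r <;> simp [initConfig]
  · rcases r with _ | _ | _ | r <;> simp [initConfig] <;> omega
  · rw [hreg]
    interval_cases r <;> simp

/-- Prologue and epilogue take `20 + 6` steps, each simulated step at most `5`. As `P` halts, the
simulation ends exactly where the epilogue begins. -/
theorem answers_queryProgram {W W' : ℕ} {P : List Instr} {T : ℕ} {D D' : List ℕ}
    {i j E k i' B Y T₁ T₂ : ℕ} {good good' : ℕ → ℕ → Prop} (h8 : 8 < 2 ^ W) (hWW : W' ≤ W)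
    (hij : i ≤ j) (hj : j < 2 ^ W)
    (hE : D.getD (j - i) 0 = E) (hEi : E + i * 8 + 8 ≤ 2 ^ W)
    (h0 : D.getD (E + i * 8) 0 = k) (h1 : D.getD (E + i * 8 + 1) 0 = i')
    (h2 : D.getD (E + i * 8 + 2) 0 = 2 ^ W') (h3 : D.getD (E + i * 8 + 3) 0 = B)
    (h4 : D.getD (E + i * 8 + 4) 0 = Y) (h5 : D.getD (E + i * 8 + 5) 0 = T₁)
    (h6 : D.getD (E + i * 8 + 6) 0 = T₂)
    (hk : k < 2 ^ W') (hj' : i' + (j - i) < 2 ^ W')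
    (hlt : ∀ a, D'.getD a 0 < 2 ^ W')
    (hin : ∀ a < Y, a + B < 2 ^ W ∧ D.getD (a + B) 0 = D'.getD a 0)
    (hout : ∀ a, Y ≤ a → a < 2 ^ W' → D'.getD a 0 = 0)
    (hans : Answers W' P T D' [k, i', i' + (j - i)] good)
    (hgood : ∀ kind p, good kind p → p + p + kind + T₁ < 2 ^ W ∧ p + p + kind + T₂ < 2 ^ W ∧
      good' (D.getD (p + p + kind + T₁) 0) (D.getD (p + p + kind + T₂) 0)) :
    Answers W (queryProgram P) (26 + 5 * T) D [i, j] good' := by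
  have hsim := simulates_queryPrologue (len := P.length)
    (post := simCode (fun t => queryPrologue.length + 5 * min t P.length) queryPrologue.length P ++
      queryEpilogue) h8 hWW hij hj hE hEi h0 h1 h2 h3 h4 h5 h6 hk hj'
  rw [← List.append_assoc] at hsim
  obtain ⟨m, hm, hsim⟩ := hsim.iterate (post := queryEpilogue) hWW rfl hlt (by simpa using hin)
    (by simpa using hout) T
  change Simulates _ _ _ _ _ ((step W (queryProgram P) D)^[m]
    ((step W (queryProgram P) D)^[queryPrologue.length] _)) at hsim
  rw [← Function.iterate_add_apply] at hsim
  obtain ⟨hhalt, hg⟩ := hans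
  set s := (step W' P D')^[T] (initConfig [k, i', i' + (j - i)])
  set s' := (step W (queryProgram P) D)^[m + queryPrologue.length] (initConfig [i, j]) with hs'
  obtain ⟨g1, g2, g3⟩ := hgood _ _ hg
  have hst : ∀ ins ∈ queryEpilogue, ins.IsStraight := by simp [queryEpilogue, Instr.IsStraight]
  have hrun := iterate_step_straight (W := W) (D := D) queryEpilogue hst
    (queryPrologue ++
      simCode (fun t => queryPrologue.length + 5 * min t P.length) queryPrologue.length P) [] s'
    (by rw [hsim.pc, min_eq_right hhalt]; simp)
  rw [List.append_nil] at hrun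
  change (step W (queryProgram P) D)^[_] s' = _ at hrun
  have hpc := pc_foldl_straight (W := W) (D := D) queryEpilogue hst s'
  have hlen : (queryProgram P).length = s'.pc + queryEpilogue.length := by
    rw [hsim.pc, min_eq_right hhalt]; simp [queryProgram, add_assoc]
  rw [hs', ← Function.iterate_add_apply] at hrun
  have hfin := iterate_step_of_halted (W := W) (P := queryProgram P) (D := D)
    (s := initConfig [i, j]) (T := 26 + 5 * T)
    (k := queryEpilogue.length + (m + queryPrologue.length))
    (by simp [queryEpilogue, queryPrologue]; omega)
    (by rw [hrun, ← hs', hpc, hlen])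
  rw [hrun, ← hs'] at hfin
  rw [Answers, hfin]
  refine ⟨by rw [hpc, hlen], ?_⟩
  have r10 : s'.reg 10 = s.reg 0 := hsim.reg 0
  have r11 : s'.reg 11 = s.reg 1 := hsim.reg 1
  have r6 : s'.reg 6 = T₁ := hsim.env 6 (by norm_num) (by norm_num)
  have r7 : s'.reg 7 = T₂ := hsim.env 7 (by norm_num) (by norm_num)
  have e1 : (s.reg 1 + s.reg 1) % 2 ^ W = s.reg 1 + s.reg 1 := Nat.mod_eq_of_lt (by omega)
  have e2 : (s.reg 1 + s.reg 1 + s.reg 0) % 2 ^ W = s.reg 1 + s.reg 1 + s.reg 0 :=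
    Nat.mod_eq_of_lt (by omega)
  simp [queryEpilogue, Instr.exec, WordOp.eval, r10, r11, r6, r7, e1, e2, Nat.mod_eq_of_lt g1,
    Nat.mod_eq_of_lt g2]
  simpa using g3

/-! ### Scales

Scale `t` has step width `2 ^ (t / 17)` and document length `(t % 17 + 1) * 2 ^ (t / 17)`, cut off at
the length `n` of the string; its documents start at the multiples of the step width. -/

def scaleStep (t : ℕ) : ℕ := 2 ^ (t / 17)

def scaleLen (n t : ℕ) : ℕ := min ((t % 17 + 1) * scaleStep t) n

/-- The scale for substrings of length `m`. -/
def scaleOf (m : ℕ) : ℕ :=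
  if m < 8 then m - 1 else 17 * (Nat.log 2 m - 3) + (m / 2 ^ (Nat.log 2 m - 3) + 1)

/-- Number of documents. -/
def scaleCount (n t : ℕ) : ℕ := n / scaleStep t + 1

/-- Clipping at `n - ℓ` gives the documents near the end of the string full length. -/
def scaleStart (n t k : ℕ) : ℕ := min (k * scaleStep t) (n - scaleLen n t)

def scaleDocs {σ : Type*} (w : List σ) (t : ℕ) (k : Fin (scaleCount w.length t)) : List σ :=
  (w.drop (scaleStart w.length t k)).take (scaleLen w.length t)

theorem scaleStep_pos (t : ℕ) : 0 < scaleStep t := by unfold scaleStep; positivity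

theorem scaleLen_le (n t : ℕ) : scaleLen n t ≤ n := min_le_right _ _

theorem scaleLen_pos {n : ℕ} (hn : 0 < n) (t : ℕ) : 0 < scaleLen n t :=
  lt_min (Nat.mul_pos (Nat.succ_pos _) (scaleStep_pos t)) hn

theorem scaleStart_add_le (n t k : ℕ) : scaleStart n t k + scaleLen n t ≤ n := by
  have h1 := scaleLen_le n t
  have h2 : scaleStart n t k ≤ n - scaleLen n t := min_le_right _ _
  omega

theorem length_scaleDocs {σ : Type*} (w : List σ) (t : ℕ) (k : Fin (scaleCount w.length t)) :
    (scaleDocs w t k).length = scaleLen w.length t := by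
  have := scaleStart_add_le w.length t k
  simp only [scaleDocs, List.length_take, List.length_drop]
  omega

/-- All documents but one are charged `ℓ ≤ 17 s` each, the remaining one `ℓ ≤ n`. -/
theorem scaleCount_mul_le (n t : ℕ) : scaleCount n t * scaleLen n t ≤ 18 * n := by
  have h1 : scaleLen n t ≤ 17 * scaleStep t :=
    (min_le_left _ _).trans (Nat.mul_le_mul_right _ (by omega))
  have h2 := Nat.div_mul_le_self n (scaleStep t)
  calc scaleCount n t * scaleLen n t = n / scaleStep t * scaleLen n t + scaleLen n t := by
        unfold scaleCount; ring
    _ ≤ n / scaleStep t * (17 * scaleStep t) + n :=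
        add_le_add (Nat.mul_le_mul_left _ h1) (scaleLen_le n t)
    _ = 17 * (n / scaleStep t * scaleStep t) + n := by ring
    _ ≤ 18 * n := by omega

/-- For `m ≥ 8`, the step width is at most an eighth of `m`. -/
theorem scaleOf_spec {m : ℕ} (hm : 8 ≤ m) :
    scaleOf m / 17 = Nat.log 2 m - 3 ∧ scaleOf m % 17 = m / scaleStep (scaleOf m) + 1 ∧
      8 * scaleStep (scaleOf m) ≤ m := by
  have h3 : 3 ≤ Nat.log 2 m := Nat.le_log_of_pow_le (by norm_num) (by simpa using hm)
  obtain ⟨b, hb⟩ := Nat.exists_eq_add_of_le h3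
  have hlo : 8 * 2 ^ b ≤ m := by
    have := Nat.pow_log_le_self 2 (x := m) (by omega)
    rw [hb, pow_add] at this
    simpa using this
  have hhi : m < 16 * 2 ^ b := by
    have := Nat.lt_pow_succ_log_self (b := 2) (by norm_num) m
    rw [hb, Nat.succ_eq_add_one, show 3 + b + 1 = 4 + b by ring, pow_add] at this
    simpa using this
  -- The quotient plus one is at most `16`, hence a residue modulo `17`.
  have hd : m / 2 ^ b < 16 := (Nat.div_lt_iff_lt_mul (by positivity)).2 hhi
  have hsc : scaleOf m = 17 * b + (m / 2 ^ b + 1) := by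
    rw [scaleOf, if_neg (by omega), hb, Nat.add_sub_cancel_left]
  have e1 : scaleOf m / 17 = b := by
    rw [hsc]; generalize m / 2 ^ b = d at hd; omega
  refine ⟨by omega, ?_, ?_⟩
  · rw [scaleStep, e1, hsc]; generalize m / 2 ^ b = d at hd ⊢; omega
  · rw [scaleStep, e1]; exact hlo

theorem scaleOf_lt {m n : ℕ} (hmn : m ≤ n) : scaleOf m < 17 * (Nat.log 2 n + 1) := by
  rcases Nat.lt_or_ge m 8 with hm | hm
  · rw [scaleOf, if_pos hm]; omega
  · have h1 := (scaleOf_spec hm).1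
    have h2 := Nat.log_mono_right (b := 2) hmn
    omega

theorem scaleLen_of_lt {m n : ℕ} (hm : 0 < m) (hm8 : m < 8) (hmn : m ≤ n) :
    scaleStep (scaleOf m) = 1 ∧ scaleLen n (scaleOf m) = m := by
  have h : scaleOf m = m - 1 := by rw [scaleOf, if_pos hm8]
  have h1 : scaleStep (scaleOf m) = 1 := by
    rw [scaleStep, h, show (m - 1) / 17 = 0 by omega, pow_zero]
  refine ⟨h1, ?_⟩
  rw [scaleLen, h1, h]
  omega

/-- Substrings of length `m` are covered by the documents together with all their occurrences. -/
theorem add_scaleStep_le {m n : ℕ} (hm8 : 8 ≤ m) :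
    m + scaleStep (scaleOf m) ≤ scaleLen n (scaleOf m) ∨ scaleLen n (scaleOf m) = n := by
  obtain ⟨-, h2, -⟩ := scaleOf_spec hm8
  have h : m + scaleStep (scaleOf m) ≤ (scaleOf m % 17 + 1) * scaleStep (scaleOf m) := by
    rw [h2]
    have := Nat.lt_div_mul_add (a := m) (scaleStep_pos (scaleOf m))
    nlinarith
  rcases le_total ((scaleOf m % 17 + 1) * scaleStep (scaleOf m)) n with h' | h'
  · left; rwa [scaleLen, min_eq_left h']
  · right; rw [scaleLen, min_eq_right h']

theorem le_scaleLen {m n : ℕ} (hm : 0 < m) (hmn : m ≤ n) : m ≤ scaleLen n (scaleOf m) := by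
  rcases Nat.lt_or_ge m 8 with hm8 | hm8
  · exact (scaleLen_of_lt hm hm8 hmn).2.ge
  · rcases add_scaleStep_le (n := n) hm8 with h | h <;> omega

/-- A position exceeds the preceding multiple of `s` by at most `s - 1`; this form, weaker by one,
also covers `m < 8`, where `s = 1` and `ℓ = m`. -/
theorem add_scaleStep_le_succ {m n : ℕ} (hm : 0 < m) (hmn : m ≤ n) :
    m + scaleStep (scaleOf m) ≤ scaleLen n (scaleOf m) + 1 ∨ scaleLen n (scaleOf m) = n := by
  rcases Nat.lt_or_ge m 8 with hm8 | hm8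
  · obtain ⟨h1, h2⟩ := scaleLen_of_lt hm hm8 hmn
    omega
  · rcases add_scaleStep_le (n := n) hm8 with h | h <;> omega

/-- For `m ≥ 8`, `8 s ≤ m` gives `ℓ ≤ m + 2 s ≤ 5 m / 4`, and `15 / 4 ≤ 4`. -/
theorem three_mul_scaleLen_le {m n : ℕ} (hm : 0 < m) (hmn : m ≤ n) :
    3 * scaleLen n (scaleOf m) ≤ 4 * m := by
  rcases Nat.lt_or_ge m 8 with hm8 | hm8
  · have := (scaleLen_of_lt hm hm8 hmn).2
    omega
  · obtain ⟨-, h2, h3⟩ := scaleOf_spec hm8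
    have h4 : scaleLen n (scaleOf m) ≤ (m / scaleStep (scaleOf m) + 2) * scaleStep (scaleOf m) := by
      refine (min_le_left _ _).trans (by rw [h2])
    have h5 := Nat.div_mul_le_self m (scaleStep (scaleOf m))
    nlinarith

/-- Only one length below `8` belongs to a scale. -/
theorem eight_le_of_scaleOf_eq {m₁ m₂ : ℕ} (h1 : 0 < m₁) (hlt : m₁ < m₂)
    (h : scaleOf m₁ = scaleOf m₂) : 8 ≤ m₂ := by
  by_contra! h8
  rw [scaleOf, scaleOf, if_pos (by omega), if_pos h8] at h
  omega

/-- The document that contains the substrings starting at position `i`. -/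
theorem scaleStart_spec {n t i m : ℕ} (him : i + m ≤ n)
    (hcov : m + scaleStep t ≤ scaleLen n t + 1 ∨ scaleLen n t = n) :
    i / scaleStep t < scaleCount n t ∧ scaleStart n t (i / scaleStep t) ≤ i ∧
      i + m ≤ scaleStart n t (i / scaleStep t) + scaleLen n t := by
  have h1 := Nat.div_mul_le_self i (scaleStep t)
  have h2 := Nat.lt_div_mul_add (a := i) (scaleStep_pos t)
  have h3 := scaleLen_le n t
  refine ⟨Nat.lt_succ_of_le (Nat.div_le_div_right (by omega)), (min_le_left _ _).trans h1, ?_⟩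
  unfold scaleStart
  omega

theorem take_drop_take_drop {σ : Type*} (w : List σ) {a l i m : ℕ} (h1 : a ≤ i)
    (h2 : i + m ≤ a + l) :
    (((w.drop a).take l).drop (i - a)).take m = (w.drop i).take m := by
  rw [List.drop_take, List.drop_drop, List.take_take, show a + (i - a) = i by omega,
    min_eq_left (by omega)]

theorem exists_infix_scaleDocs {σ : Type*} {w r : List σ} {t : ℕ} (hr : r <:+: w)
    (hcov : r.length + scaleStep t ≤ scaleLen w.length t + 1 ∨ scaleLen w.length t = w.length) :
    ∃ k, r <:+: scaleDocs w t k := by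
  obtain ⟨p, q, hw⟩ := hr
  obtain ⟨h1, h2, h3⟩ := scaleStart_spec (i := p.length) (m := r.length) (n := w.length) (t := t)
    (by simp [← hw]) hcov
  refine ⟨⟨_, h1⟩, ?_⟩
  have h4 : (w.drop p.length).take r.length = r := by
    rw [← hw, List.append_assoc, List.drop_left, List.take_left]
  have h5 : r <:+: ((scaleDocs w t ⟨_, h1⟩).drop
      (p.length - scaleStart w.length t (p.length / scaleStep t))) := by
    rw [← h4, ← take_drop_take_drop w h2 h3]
    exact (List.take_prefix _ _).isInfix
  exact h5.trans (List.drop_suffix _ _).isInfix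

/-- The start of the last document is clipped, which makes it the suffix of `w` of length `ℓ`. -/
theorem suffix_scaleDocs {σ : Type*} (w : List σ) (t : ℕ) :
    ∃ k, ∀ r, r <:+ w → r.length ≤ scaleLen w.length t → r <:+ scaleDocs w t k := by
  refine ⟨⟨w.length / scaleStep t, Nat.lt_succ_self _⟩, fun r hr hl => ?_⟩
  have h1 := Nat.lt_div_mul_add (a := w.length) (scaleStep_pos t)
  have h2 := scaleLen_le w.length t
  have h4 : scaleStep t ≤ (t % 17 + 1) * scaleStep t := Nat.le_mul_of_pos_left _ (Nat.succ_pos _)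
  have h3 : scaleStart w.length t (w.length / scaleStep t) = w.length - scaleLen w.length t := by
    refine min_eq_right ?_
    unfold scaleLen
    omega
  have h5 : scaleDocs w t ⟨w.length / scaleStep t, Nat.lt_succ_self _⟩ =
      w.drop (w.length - scaleLen w.length t) := by
    simp only [scaleDocs, h3]
    exact List.take_of_length_le (by rw [List.length_drop]; omega)
  rw [h5]
  exact List.suffix_of_suffix_length_le hr (List.drop_suffix _ _) (by rw [List.length_drop]; omega)

/-- The substrings that are queried on scale `t`. -/
def scaleStrings {σ : Type*} (w : List σ) (t : ℕ) : Set (List σ) :=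
  {s | s <:+: w ∧ 0 < s.length ∧ scaleOf s.length = t}

/-- On each scale, pointers can be translated by a table. -/
theorem exists_translation {σ : Type*} {w : List σ} (t : ℕ)
    {ptr : List (σ ⊕ Fin (scaleCount w.length t)) → ℕ} {ptr' : List (σ ⊕ Fin 1) → ℕ}
    (hptr : IsPointerMap (scaleDocs w t) ptr) (hptr' : IsPointerMap (fun _ : Fin 1 => w) ptr') :
    ∃ f g : ℕ → ℕ → ℕ, (∀ kind p, f kind p ≤ 1 ∧ g kind p ≤ 4 + 2 * w.length) ∧
      ∀ s ∈ scaleStrings w t, ∀ kind p, PointsTo (scaleDocs w t) ptr s kind p →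
        PointsTo (fun _ : Fin 1 => w) ptr' s (f kind p) (g kind p) := by
  classical
  obtain ⟨N, hN⟩ := hptr
  obtain ⟨N', hN'⟩ := hptr'
  have hb := pointer_bound (m := w.length) (fun _ => rfl) hN'
  have key : ∀ kind p, ∃ kind' p', (kind' ≤ 1 ∧ p' ≤ 4 + 2 * w.length) ∧
      ∀ s ∈ scaleStrings w t, PointsTo (scaleDocs w t) ptr s kind p →
        PointsTo (fun _ : Fin 1 => w) ptr' s kind' p' := by
    intro kind p
    by_cases hne : ∃ s ∈ scaleStrings w t, PointsTo (scaleDocs w t) ptr s kind p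
    · obtain ⟨kind', p', ⟨s, hs⟩, h⟩ := exists_pointsTo_of_pointsTo ptr' (scaleStrings w t) hN.injOn
        (fun s hs => hs.1) (fun s₁ hs₁ s₂ hs₂ hlt r hr hl => by
          have h8 := eight_le_of_scaleOf_eq hs₁.2.1 hlt (hs₁.2.2.trans hs₂.2.2.symm)
          refine exists_infix_scaleDocs hr ?_
          -- As `s ≥ 1`, there is room for one letter more than in `s₂`.
          have := add_scaleStep_le (n := w.length) h8
          rw [hs₂.2.2] at this
          omega) (by
          obtain ⟨k, hk⟩ := suffix_scaleDocs w t
          refine ⟨k, fun s hs r hr hl => hk r hr ?_⟩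
          have := le_scaleLen hs.2.1 hs.1.length_le
          rw [hs.2.2] at this
          omega) hne
      exact ⟨kind', p', ⟨hs.kind_le, by have := hs.lt hN'; omega⟩, h⟩
    · exact ⟨0, 0, by simp, fun s hs h => absurd ⟨s, hs, h⟩ hne⟩
  choose f g h1 h2 using key
  exact ⟨f, g, h1, fun s hs kind p => h2 kind p s hs⟩

/-! ### The memory

The memory consists of regions of `Q` words each. Region `0` contains, at address `m - 1`, the start
of the region for substrings of length `m`. Region `t + 1` belongs to scale `t` and contains records
of `8` words for the positions of the string, then `Y` words for the long substring retrieval data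
structure, and two translation tables of `218 * n` words each. -/

/-- Word `f` of the record of position `i`; `R` is the start of the region. -/
def recordWord (n Y M R t i f : ℕ) : ℕ :=
  if f = 0 then i / scaleStep t
  else if f = 1 then i - scaleStart n t (i / scaleStep t)
  else if f = 2 then M
  else if f = 3 then R + 8 * n
  else if f = 4 then Y
  else if f = 5 then R + 8 * n + Y
  else R + 8 * n + Y + 218 * n

/-- The tables store the translation of the pointer `(kind, p)` at index `2 * p + kind`. -/
def regionWord (n Y M R t : ℕ) (D : List ℕ) (f g : ℕ → ℕ → ℕ) (q : ℕ) : ℕ :=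
  if q < 8 * n then recordWord n Y M R t (q / 8) (q % 8)
  else if q < 8 * n + Y then D.getD (q - 8 * n) 0
  else if q < 8 * n + Y + 218 * n then
    f ((q - (8 * n + Y)) % 2) ((q - (8 * n + Y)) / 2)
  else g ((q - (8 * n + Y + 218 * n)) % 2) ((q - (8 * n + Y + 218 * n)) / 2)

def memWord (n Q Y M : ℕ) (D : ℕ → List ℕ) (f g : ℕ → ℕ → ℕ → ℕ) (a : ℕ) : ℕ :=
  if a < Q then if a < n then Q * (scaleOf (a + 1) + 1) else 0
  else regionWord n Y M (Q * (a / Q)) (a / Q - 1) (D (a / Q - 1)) (f (a / Q - 1)) (g (a / Q - 1))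
    (a % Q)

theorem memWord_region {n Q Y M : ℕ} {D : ℕ → List ℕ} {f g : ℕ → ℕ → ℕ → ℕ} {t q : ℕ}
    (hq : q < Q) : memWord n Q Y M D f g (Q * (t + 1) + q) =
      regionWord n Y M (Q * (t + 1)) t (D t) (f t) (g t) q := by
  have h1 : (Q * (t + 1) + q) / Q = t + 1 := by
    rw [Nat.mul_add_div (by omega), Nat.div_eq_of_lt hq, Nat.add_zero]
  have h2 : (Q * (t + 1) + q) % Q = q := by
    rw [Nat.mul_add_mod, Nat.mod_eq_of_lt hq]
  have h3 : ¬ Q * (t + 1) + q < Q := by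
    have : Q * (t + 1) = Q * t + Q := by ring
    omega
  rw [memWord, if_neg h3, h1, h2, Nat.add_sub_cancel]

theorem memWord_lt {n Q Y M L : ℕ} {D : ℕ → List ℕ} {f g : ℕ → ℕ → ℕ → ℕ}
    (hn : 0 < n) (hQ : Q = 444 * n + Y)
    (hM : M < L) (hL : (17 * (Nat.log 2 n + 1) + 1) * Q ≤ L) (hD : ∀ t a, (D t).getD a 0 < L)
    (hf : ∀ t kind p, f t kind p ≤ 1 ∧ g t kind p ≤ 4 + 2 * n) {a : ℕ}
    (ha : a < (17 * (Nat.log 2 n + 1) + 1) * Q) : memWord n Q Y M D f g a < L := by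
  have hQL : Q < L := by nlinarith [Nat.zero_le (Nat.log 2 n * Q)]
  unfold memWord
  split_ifs with h1 h2
  · have h3 := scaleOf_lt (m := a + 1) (n := n) h2
    have h4 : Q * (scaleOf (a + 1) + 1) < (17 * (Nat.log 2 n + 1) + 1) * Q := by
      rw [mul_comm]
      exact Nat.mul_lt_mul_of_pos_right (by omega) (by omega)
    omega
  · omega
  · have h3 : Q * (a / Q) + Q ≤ L := by
      have h4 : a / Q < 17 * (Nat.log 2 n + 1) + 1 := (Nat.div_lt_iff_lt_mul (by omega)).2 ha
      have h5 := Nat.mul_le_mul_right Q h4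
      have h6 : (a / Q).succ * Q = Q * (a / Q) + Q := by rw [Nat.succ_mul, mul_comm]
      omega
    generalize a / Q = b at h3
    generalize a % Q = q
    generalize Q * b = R at h3
    unfold regionWord
    split_ifs with h5
    · have h6 : q / 8 / scaleStep (b - 1) ≤ q / 8 := Nat.div_le_self _ _
      unfold recordWord
      split_ifs <;> omega
    · exact hD _ _
    · have := (hf (b - 1) ((q - (8 * n + Y)) % 2) ((q - (8 * n + Y)) / 2)).1
      omega
    · have := (hf (b - 1) ((q - (8 * n + Y + 218 * n)) % 2) ((q - (8 * n + Y + 218 * n)) / 2)).2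
      omega

theorem getD_map_range {f : ℕ → ℕ} {L a : ℕ} (ha : a < L) :
    ((List.range L).map f).getD a 0 = f a := by
  simp [List.getD, List.getElem?_range ha]

theorem getD_lt_of_forall_lt {D : List ℕ} {L : ℕ} (hL : 0 < L) (h : ∀ x ∈ D, x < L) (a : ℕ) :
    D.getD a 0 < L := by
  rcases Nat.lt_or_ge a D.length with ha | ha
  · rw [List.getD_eq_getElem _ _ ha]; exact h _ (List.getElem_mem _)
  · rwa [List.getD_eq_default _ _ ha]

/-- The memory is addressable. -/
theorem memory_size_le {n Y κ : ℕ} (hn : 0 < n) (hκ : 1 ≤ κ) (hY : Y ≤ 2 ^ wordSize κ n) :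
    (17 * (Nat.log 2 n + 1) + 1) * (444 * n + Y) ≤ 2 ^ wordSize (κ + 14) n := by
  set g := Nat.log 2 n + 1 with hg
  have h1 : n < 2 ^ g := Nat.lt_pow_succ_log_self (by norm_num) n
  have h2 : g < 2 ^ g := Nat.lt_two_pow_self
  have h3 : 2 ^ g ≤ 2 ^ wordSize κ n :=
    Nat.pow_le_pow_right (by norm_num) (Nat.le_mul_of_pos_left _ hκ)
  -- The constant is `18 * 445`; of the `14` additional units of word size, `13` absorb it and one
  -- absorbs the number of scales.
  have h4 : 8010 ≤ 2 ^ (13 * g) :=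
    calc 8010 ≤ 2 ^ 13 := by norm_num
      _ ≤ 2 ^ (13 * g) := Nat.pow_le_pow_right (by norm_num) (by omega)
  have h5 : 2 ^ wordSize (κ + 14) n = 2 ^ (13 * g) * (2 ^ g * 2 ^ wordSize κ n) := by
    rw [← pow_add, ← pow_add, wordSize, wordSize, ← hg]; congr 1; ring
  rw [h5]
  generalize 2 ^ wordSize κ n = M at h3 hY
  generalize 2 ^ g = G at h1 h2 h3
  generalize 2 ^ (13 * g) = H at h4
  calc (17 * g + 1) * (444 * n + Y) ≤ (18 * G) * (445 * M) :=
        Nat.mul_le_mul (by omega) (by omega)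
    _ = 8010 * (G * M) := by ring
    _ ≤ _ := Nat.mul_le_mul_right _ h4

/-- With `β` documents of length `ℓ ≥ 1`, `β (ℓ + 2) ≤ 3 β ℓ ≤ 54 n`. This gives tables of `2 * 109
n = 218 n` words. -/
theorem scale_pointer_bound {σ : Type*} {w : List σ} (hw : 0 < w.length) {t N : ℕ}
    {ptr : List (σ ⊕ Fin (scaleCount w.length t)) → ℕ}
    (hN : Set.BijOn ptr {x | IsExplicit (scaleDocs w t) x} (Set.Iio N)) : N ≤ 109 * w.length := by
  have h1 := pointer_bound (length_scaleDocs w t) hN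
  have h2 := scaleCount_mul_le w.length t
  have h3 := scaleLen_pos hw t
  have h4 : scaleCount w.length t * (scaleLen w.length t + 2) ≤
      scaleCount w.length t * (3 * scaleLen w.length t) := Nat.mul_le_mul_left _ (by omega)
  rw [Nat.mul_left_comm] at h4
  omega

theorem length_substr {σ : Type*} {w : List σ} {i j : ℕ} (hij : i ≤ j) (hj : j < w.length) :
    (substr w i j).length = j - i + 1 := by
  simp only [substr, List.length_take, List.length_drop]
  omega

theorem substr_infix {σ : Type*} (w : List σ) (i j : ℕ) : substr w i j <:+: w :=
  (List.take_prefix _ _).isInfix.trans (List.drop_suffix _ _).isInfix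

end SubstringRetrieval

/-! ### Assembling the data structure -/

open SubstringRetrieval in
theorem mainTheorem8 {σ : Type*} (S : ℕ → ℕ)
    (hS : SubstringRetrieval.LongSolvable σ S) :
    SubstringRetrieval.GeneralSolvable σ (fun n => (S n + n) * (Nat.log 2 n + 1)) := by
  classical
  obtain ⟨κ₀, hS⟩ := hS 18
  -- The simulated machine gets `κ - 14`, which must be at least `κ₀` and positive.
  refine ⟨κ₀ + 15, fun κ hκ => ?_⟩
  obtain ⟨κ, rfl⟩ : ∃ κ', κ = κ' + 14 := ⟨κ - 14, by omega⟩
  obtain ⟨P, T, A, hP⟩ := hS κ (by omega)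
  refine ⟨queryProgram P, 26 + 5 * T, 18 * (444 + A), ?_⟩
  intro w ptr' docs hptr'
  set n := w.length with hn
  rcases Nat.eq_zero_or_pos n with h0 | hpos
  · exact ⟨[], by simp, by simp, fun i j _ hj => absurd hj (by omega)⟩
  have hex : ∀ t, ∃ ptr, IsPointerMap (scaleDocs w t) ptr := fun t =>
    exists_isPointerMap _ (length_scaleDocs w t)
  choose ptr hptr using hex
  have hlong := fun t => hP w (scaleLen n t) (scaleCount n t) (fun k => scaleStart n t k) (ptr t)
    (scaleLen_pos hpos t) (scaleCount_mul_le n t) (fun k => scaleStart_add_le n t k) (hptr t)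
  choose D hDlen hDlt hD using hlong
  choose f g hfg htrans using fun t => exists_translation t (hptr t) hptr'
  set W := wordSize (κ + 14) n with hW
  set W' := wordSize κ n with hW'
  -- Words of a long substring structure beyond address `2 ^ W'` are unreachable for the simulated
  -- program and need not be stored.
  set Y := min (A * S n) (2 ^ W') with hY
  set Q := 444 * n + Y with hQ
  set L := (17 * (Nat.log 2 n + 1) + 1) * Q with hL
  have hLW : L ≤ 2 ^ W := memory_size_le hpos (by omega) (min_le_right _ _)
  have hWW : W' < W := by
    rw [hW, hW', wordSize, wordSize]
    exact Nat.mul_lt_mul_of_pos_right (by omega) (by omega)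
  have hpow : 2 ^ W' < 2 ^ W := Nat.pow_lt_pow_right (by norm_num) hWW
  have hn' : n < 2 ^ W' := by
    refine (Nat.lt_pow_succ_log_self (b := 2) (by norm_num) n).trans_le
      (Nat.pow_le_pow_right (by norm_num) ?_)
    exact Nat.le_mul_of_pos_left _ (by omega)
  have hDlt' : ∀ t a, (D t).getD a 0 < 2 ^ W' := fun t =>
    getD_lt_of_forall_lt (by positivity) (hDlt t)
  set mem := (List.range L).map (memWord n Q Y (2 ^ W') D f g) with hmem
  have hget : ∀ t < 17 * (Nat.log 2 n + 1), ∀ q < Q, Q * (t + 1) + q < 2 ^ W ∧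
      mem.getD (Q * (t + 1) + q) 0 =
        regionWord n Y (2 ^ W') (Q * (t + 1)) t (D t) (f t) (g t) q := by
    intro t ht q hq
    have hlt : Q * (t + 1) + q < L := by
      have h1 : Q * (t + 2) ≤ L := by
        rw [hL, mul_comm Q]; exact Nat.mul_le_mul_right _ (by omega)
      have h2 : Q * (t + 2) = Q * (t + 1) + Q := by ring
      omega
    exact ⟨hlt.trans_le hLW, by rw [hmem, getD_map_range hlt, memWord_region hq]⟩
  refine ⟨mem, ?_, ?_, ?_⟩
  · have h1 : Y ≤ A * S n := min_le_left _ _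
    rw [hmem, List.length_map, List.length_range, hL]
    calc (17 * (Nat.log 2 n + 1) + 1) * Q
        ≤ (18 * (Nat.log 2 n + 1)) * ((444 + A) * (S n + n)) :=
          Nat.mul_le_mul (by omega) (by nlinarith [Nat.zero_le (A * n), Nat.zero_le (S n)])
      _ = _ := by ring
  · intro x hx
    obtain ⟨a, ha, rfl⟩ := List.mem_map.1 hx
    exact memWord_lt hpos hQ hpow hLW (fun t a => (hDlt' t a).trans hpow) hfg (List.mem_range.1 ha)
  · intro i j hij hj
    set m := j - i + 1 with hm
    set t := scaleOf m with ht
    have hmn : m ≤ n := by omega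
    have htlt : t < 17 * (Nat.log 2 n + 1) := scaleOf_lt hmn
    have hget' := hget t htlt
    obtain ⟨hk, hs1, hs2⟩ := scaleStart_spec (n := n) (i := i) (m := m) (by omega)
      (add_scaleStep_le_succ (Nat.succ_pos _) hmn)
    rw [← ht] at hk hs1 hs2
    set k := i / scaleStep t with hkdef
    have hl := scaleLen_le n t
    have hrec : ∀ x < 8, mem.getD (Q * (t + 1) + i * 8 + x) 0 =
        recordWord n Y (2 ^ W') (Q * (t + 1)) t i x := by
      intro x hx
      rw [add_assoc, (hget' _ (by omega)).2, regionWord, if_pos (by omega),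
        show (i * 8 + x) / 8 = i by omega, show (i * 8 + x) % 8 = x by omega]
    have hkn : k ≤ n := (Nat.div_le_self _ _).trans (by omega)
    have hE : mem.getD (j - i) 0 = Q * (t + 1) := by
      have h1 : j - i < Q := by omega
      have h2 : j - i < L := h1.trans_le (Nat.le_mul_of_pos_left _ (Nat.succ_pos _))
      rw [hmem, getD_map_range h2, memWord, if_pos h1, if_pos (by omega)]
    have hans := hD t ⟨k, hk⟩ (i - scaleStart n t k) (i - scaleStart n t k + (j - i)) (by omega)
      (by omega) (by
        have := three_mul_scaleLen_le (m := m) (n := n) (Nat.succ_pos _) hmn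
        rw [← ht] at this
        omega)
    refine answers_queryProgram (W' := W') (D' := D t) (E := Q * (t + 1)) (k := k)
      (i' := i - scaleStart n t k) (B := Q * (t + 1) + 8 * n) (Y := Y)
      (T₁ := Q * (t + 1) + 8 * n + Y) (T₂ := Q * (t + 1) + 8 * n + Y + 218 * n)
      ?_ hWW.le hij (by omega) hE ?_ (hrec 0 (by norm_num)) (hrec 1 (by norm_num))
      (hrec 2 (by norm_num)) (hrec 3 (by norm_num)) (hrec 4 (by norm_num)) (hrec 5 (by norm_num))
      (hrec 6 (by norm_num)) (by omega) (by omega) (hDlt' t) ?_ ?_ hans ?_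
    · have := (hget' 8 (by omega)).1
      omega
    · have := (hget' (i * 8 + 7) (by omega)).1
      omega
    · intro a ha
      obtain ⟨h1, h2⟩ := hget' (8 * n + a) (by omega)
      rw [show a + (Q * (t + 1) + 8 * n) = Q * (t + 1) + (8 * n + a) by ring]
      refine ⟨h1, ?_⟩
      rw [h2, regionWord, if_neg (by omega), if_pos (by omega), Nat.add_sub_cancel_left]
    -- Since `Y ≤ a < 2 ^ W'`, the minimum `Y` is `A * S n`, so `a` lies beyond the end of `D t`.
    · intro a ha1 ha2
      refine List.getD_eq_default _ _ ?_
      have := hDlen t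
      change (D t).length ≤ A * S n at this
      omega
    · intro kind p hp
      change PointsTo (scaleDocs w t) (ptr t) (substr (scaleDocs w t ⟨k, hk⟩) _ _) kind p at hp
      have hsub : substr (scaleDocs w t ⟨k, hk⟩) (i - scaleStart n t k)
          (i - scaleStart n t k + (j - i)) = substr w i j := by
        have := take_drop_take_drop w (m := m) hs1 hs2
        rw [substr, substr, show i - scaleStart n t k + (j - i) + 1 - (i - scaleStart n t k) = m by
          omega, show j + 1 - i = m by omega]
        exact this
      rw [hsub] at hp
      have h1 := hp.kind_le
      obtain ⟨N, hN⟩ := hptr t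
      have h2 := hp.lt hN
      have h3 := scale_pointer_bound hpos hN
      obtain ⟨g1, g2⟩ := hget' (8 * n + Y + (p + p + kind)) (by omega)
      obtain ⟨g3, g4⟩ := hget' (8 * n + Y + 218 * n + (p + p + kind)) (by omega)
      rw [show p + p + kind + (Q * (t + 1) + 8 * n + Y) =
          Q * (t + 1) + (8 * n + Y + (p + p + kind)) by ring,
        show p + p + kind + (Q * (t + 1) + 8 * n + Y + 218 * n) =
          Q * (t + 1) + (8 * n + Y + 218 * n + (p + p + kind)) by ring]
      refine ⟨g1, g3, ?_⟩
      -- As `p < 109 * n` and `kind ≤ 1`, the index `2 * p + kind` lies within the tables and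
      -- determines both numbers.
      rw [g2, g4, regionWord, regionWord, if_neg (by omega), if_neg (by omega), if_pos (by omega),
        if_neg (by omega), if_neg (by omega), if_neg (by omega), Nat.add_sub_cancel_left,
        Nat.add_sub_cancel_left, show (p + p + kind) % 2 = kind by omega,
        show (p + p + kind) / 2 = p by omega]
      refine htrans t _ ⟨substr_infix w i j, ?_, ?_⟩ _ _ hp
      · rw [length_substr hij hj]; omega
      · rw [length_substr hij hj]
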